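/- Let $\langle X,Y\rangle$ be the free monoid of words in two noncommuting letters, and let $\beta=(\beta_w)_{|w|\le 4}$ be a real sequence indexed by the words of length at most $4$ which is tracial: $\beta_v=\beta_w$ whenever $v$ is a cyclic permutation of $w$, and $\beta_{w^*}=\beta_w$, where $w^*$ is the reverse of $w$. Assume that $\beta$ is normalized ($\beta_1=1$) and noncommutative ($\beta_{X^2Y^2}\ne\beta_{XYXY}$). Let $\mathcal M_2=(\beta_{U^*V})_{U,V\in\{1,X,Y,X^2,XY,YX,Y^2\}}$ be its moment matrix, and let $w(\mathbb X,\mathbb Y)$ denote the column of $\mathcal M_2$ indexed by $w$, with $\mathbb 1$ the column indexed by the empty word. A representing measure for $\beta$ consists of finitely many pairs (atoms) $(A_i,B_i)$ of real symmetric $t_i\times t_i$ matrices, $t_i\ge 1$, with densities $\lambda_i>0$, $\sum_i\lambda_i=1$, such that $\beta_w=\sum_i\lambda_i\frac1{t_i}\operatorname{tr}\big(w(A_i,B_i)\big)$ for all $|w|\le 4$. It is of type $(m_1,\dots,m_r)$ if it has exactly $m_s$ atoms of size $s$ for $s\le r$, none of size $>r$, and $m_r\neq0$. It is minimal if no other representing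 measure has a type $(m_1',\dots,m_{r'}')$ with $r'<r$, or with $r'=r$ and $m'_s<m_s$ for the largest $s$ such that $m'_s\ne m_s$. The sequence $\beta$ admits an nc measure if it has a minimal representing measure of type $(m_1,\dots,m_r)$ with $r>1$. Two representing measures are orthogonally equivalent if, after a bijection between their atoms, corresponding atoms have equal densities and are conjugate by a common orthogonal matrix, $(A,B)\mapsto(UAU^t,UBU^t)$. Theorem. Suppose that $\mathcal M_2$ has rank $5$ and satisfies the column relations $\mathbb{XY}+\mathbb{YX}=\mathbf 0$ and $\mathbb X^2+\mathbb Y^2=\mathbb 1$. Then $\beta$ admits an nc measure if and only if $$|\beta_Y|<1-|\beta_X|,\qquad |\beta_X|<\beta_{X^2}<1-|\beta_Y|,\qquad c\le\beta_{X^4}<\beta_{X^2},$$ where $$c=\frac{-\beta_{X^2}^2-|\beta_X|+2\beta_{X^2}|\beta_X|+|\beta_Y\beta_X|}{-1+|\beta_Y|+|\beta_X|}.$$ Moreover, if $\beta$ admits an nc measure, then, counting up to orthogonal equivalence: 1. there is exactly one minimal measure, and it is of type $(1,1)$, if and only if $\beta_X\beta_Y=0$ and $\beta_{X^4}=c$;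 2. there is exactly one minimal measure, and it is of type $(2,1)$, if and only if either exactly one of $\beta_X,\beta_Y$ is zero and $\beta_{X^4}\ne c$, or $\beta_X\beta_Y\neq0$ and $\beta_{X^4}=c$; 3. there are exactly two minimal measures, and both are of type $(2,1)$, if and only if $\beta_X=\beta_Y=0$; 4. there are exactly two minimal measures, and both are of type $(3,1)$, if and only if $\beta_X\beta_Y\ne0$ and $\beta_{X^4}\ne c$. -/

import Mathlib

namespace TracialMoment

/-- The two noncommuting letters. -/
inductive Letter
  | X
  | Y

/-- Words in the noncommuting letters `X`, `Y`; the empty list is the word `1`. -/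
abbrev Word := List Letter

/-- The matrix `w(A, B)`. -/
def evalWord {t : ℕ} (A B : Matrix (Fin t) (Fin t) ℝ) (w : Word) : Matrix (Fin t) (Fin t) ℝ :=
  (w.map fun l => match l with
    | Letter.X => A
    | Letter.Y => B).prod

/-- A quartic tracial sequence `(β_w)_{|w| ≤ 4}`: invariant under cyclic permutations and reversal.
Only the values of `β` on words of length at most `4` are ever used. -/
def IsTracial (β : Word → ℝ) : Prop :=
  (∀ v w : Word, v.length ≤ 4 → v.IsRotated w → β v = β w) ∧
  (∀ w : Word, w.length ≤ 4 → β w.reverse = β w)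

/-- `β` is normalized. -/
def IsNormalized (β : Word → ℝ) : Prop := β [] = 1

open Letter in
/-- `β` is a noncommutative sequence. -/
def IsNoncommutative (β : Word → ℝ) : Prop := β [X, X, Y, Y] ≠ β [X, Y, X, Y]

open Letter in
/-- The words of length at most two in degree-lexicographic order:
`1, X, Y, X², XY, YX, Y²`. -/
def wordsTwo : Fin 7 → Word :=
  ![[], [X], [Y], [X, X], [X, Y], [Y, X], [Y, Y]]

/-- The truncated moment matrix of order two: the entry in row `U` and column `V` is `β_{U* V}`. -/
def momentMatrix (β : Word → ℝ) : Matrix (Fin 7) (Fin 7) ℝ :=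
  Matrix.of fun i j => β ((wordsTwo i).reverse ++ wordsTwo j)

/-- A finitely atomic tracial measure: finitely many pairs of real symmetric matrices
(`atomX i`, `atomY i`) of size `size i ≥ 1` with positive densities of sum one. -/
structure AtomicMeasure where
  N : ℕ
  size : Fin N → ℕ
  size_pos : ∀ i, 0 < size i
  density : Fin N → ℝ
  density_pos : ∀ i, 0 < density i
  sum_density : ∑ i, density i = 1
  atomX : ∀ i, Matrix (Fin (size i)) (Fin (size i)) ℝ
  atomY : ∀ i, Matrix (Fin (size i)) (Fin (size i)) ℝ
  symmX : ∀ i, (atomX i).IsSymm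
  symmY : ∀ i, (atomY i).IsSymm

namespace AtomicMeasure

/-- The moment of `w`: the sum of the densities times the normalized traces of `w` at the atoms. -/
noncomputable def moment (μ : AtomicMeasure) (w : Word) : ℝ :=
  ∑ i, μ.density i * ((μ.size i : ℝ)⁻¹ * (evalWord (μ.atomX i) (μ.atomY i) w).trace)

/-- `μ` is a representing measure for `(β_w)_{|w| ≤ 4}`. -/
def Represents (μ : AtomicMeasure) (β : Word → ℝ) : Prop :=
  ∀ w : Word, w.length ≤ 4 → β w = μ.moment w

/-- The number of atoms of size `s`. -/
def atomCount (μ : AtomicMeasure) (s : ℕ) : ℕ :=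
  (Finset.univ.filter fun i => μ.size i = s).card

/-- The largest size of an atom. -/
def maxSize (μ : AtomicMeasure) : ℕ := Finset.univ.sup μ.size

/-- The type `(m₁, …, m_r)`: `m_s` is the number of atoms of size `s`, and `r` is the largest
size that occurs. -/
def type (μ : AtomicMeasure) : List ℕ :=
  (List.range μ.maxSize).map fun k => μ.atomCount (k + 1)

/-- The type of `ν` is strictly smaller than the type of `μ`: either the largest size is smaller,
or the largest sizes agree and, at the largest size at which the numbers of atoms differ,
`ν` has fewer atoms. -/
def SmallerType (ν μ : AtomicMeasure) : Prop :=
  ν.maxSize < μ.maxSize ∨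
    (ν.maxSize = μ.maxSize ∧
      ∃ s, ν.atomCount s < μ.atomCount s ∧ ∀ s', s < s' → ν.atomCount s' = μ.atomCount s')

/-- `μ` is a minimal representing measure for `β`. -/
def IsMinimal (μ : AtomicMeasure) (β : Word → ℝ) : Prop :=
  μ.Represents β ∧ ∀ ν : AtomicMeasure, ν.Represents β → ¬ ν.SmallerType μ

/-- Orthogonal equivalence: after a bijection of the atoms, the densities agree and corresponding
atoms are conjugate by an orthogonal matrix (the two equations for `U` force equal sizes). -/
def OrthEquiv (μ ν : AtomicMeasure) : Prop :=
  ∃ σ : Fin μ.N ≃ Fin ν.N, ∀ i, μ.density i = ν.density (σ i) ∧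
    ∃ U : Matrix (Fin (ν.size (σ i))) (Fin (μ.size i)) ℝ,
      U * U.transpose = 1 ∧ U.transpose * U = 1 ∧
      ν.atomX (σ i) = U * μ.atomX i * U.transpose ∧
      ν.atomY (σ i) = U * μ.atomY i * U.transpose

end AtomicMeasure

/-- `β` admits an nc measure: it has a minimal representing measure whose largest atom has
size greater than one. -/
def AdmitsNCMeasure (β : Word → ℝ) : Prop :=
  ∃ μ : AtomicMeasure, μ.IsMinimal β ∧ 1 < μ.maxSize

/-- Up to orthogonal equivalence there is exactly one minimal measure for `β`, and its type
is `t`. -/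
def HasUniqueMinimal (β : Word → ℝ) (t : List ℕ) : Prop :=
  ∃ μ : AtomicMeasure, μ.IsMinimal β ∧ μ.type = t ∧
    ∀ ν : AtomicMeasure, ν.IsMinimal β → ν.OrthEquiv μ

/-- Up to orthogonal equivalence there are exactly two minimal measures for `β`, and their type
is `t`. -/
def HasExactlyTwoMinimal (β : Word → ℝ) (t : List ℕ) : Prop :=
  ∃ μ₁ μ₂ : AtomicMeasure, μ₁.IsMinimal β ∧ μ₂.IsMinimal β ∧ μ₁.type = t ∧ μ₂.type = t ∧
    ¬ μ₁.OrthEquiv μ₂ ∧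
    ∀ ν : AtomicMeasure, ν.IsMinimal β → ν.OrthEquiv μ₁ ∨ ν.OrthEquiv μ₂

open Letter in
/-- The lower bound `c` for `β_{X⁴}`. -/
noncomputable def lowerBound (β : Word → ℝ) : ℝ :=
  (-(β [X, X]) ^ 2 - |β [X]| + 2 * β [X, X] * |β [X]| + |β [Y] * β [X]|) /
    (-1 + |β [Y]| + |β [X]|)

end TracialMoment

/-! Write `a, b, p, q` for the values of `β` at `X, Y, X², X⁴`, and set `d = p - q`, `P₀ = p - |a|`,
`Q₀ = 1 - p - |b|`. Traciality and the column relations determine `β` up to degree four by `a, b, p,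
q` (`CircleRelations.eq_circleValue`); in particular `d` is the moment of `X²Y²`, and
noncommutativity means `d ≠ 0`. The moments of `(XY + YX)²` and `(X² + Y² - 1)²` vanish, so every
atom of a representing measure satisfies both relations exactly (`Represents.isCircular`).

Necessity is spectral. For such an atom `tr A^(2k+1) = tr A` for all `k`, while the spectrum of `A`
lies in `[-1, 1]`. Letting `k → ∞` in `|tr A| ≤ tr A^(2k)` bounds `|tr A|` by the multiplicity of
the eigenvalue `1` of `A²`, and likewise `|tr B|` by that of the eigenvalue `0` of `A²`
(`exists_spectrum_of_circle`). Dominating these indicators by quadratics in `A²` gives inequalities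
between `a, b, p, q`; the best choice gives `d (P₀ + Q₀) ≤ P₀ Q₀`, which is `c ≤ q`.

For sufficiency and the count, the atoms of size one are the four points `(±1, 0)`, `(0, ±1)`, and
an atom of size two with `AB ≠ 0` has a normal form with `A² = s` (`exists_orthogonal_normal_form`).
A measure with one such atom, of density `W`, is governed by `P = W s` and `Q = W (1 - s)`: its
parameters form the part of the curve `PQ = d (P + Q)` in the rectangle `0 < P ≤ P₀`, `0 < Q ≤ Q₀`
(`Feasible`). Inside the rectangle all four points are needed; on the edge `P = P₀` the pair `(±1,
0)` costs one point if `a ≠ 0` and none if `a = 0`, and similarly for `Q = Q₀` and `b`. If `q = c`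
the curve meets the rectangle only in its corner; if `q > c` it is an arc with one endpoint on each
of these edges. Comparing the endpoints gives the four cases. Rank five excludes `a = b = 0`, `q =
c`. -/

namespace TracialMoment

open Letter Matrix

/-! ### Reduction of the sequence to four parameters -/

section Words

/-- A normalized tracial sequence satisfying the relations `XY + YX = 0` and `X² + Y² = 1` on the
words of length at most four. -/
structure CircleRelations (β : Word → ℝ) : Prop where
  tracial : IsTracial β
  one : β [] = 1
  anticomm : ∀ r : Word, r.length ≤ 2 → β (r ++ [X, Y]) + β (r ++ [Y, X]) = 0
  circle : ∀ r : Word, r.length ≤ 2 → β (r ++ [X, X]) + β (r ++ [Y, Y]) = β r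

theorem exists_wordsTwo_reverse {r : Word} (hr : r.length ≤ 2) :
    ∃ i, (wordsTwo i).reverse = r := by
  match r, hr with
  | [], _ => exact ⟨0, rfl⟩
  | [X], _ => exact ⟨1, rfl⟩
  | [Y], _ => exact ⟨2, rfl⟩
  | [X, X], _ => exact ⟨3, rfl⟩
  | [Y, X], _ => exact ⟨4, rfl⟩
  | [X, Y], _ => exact ⟨5, rfl⟩
  | [Y, Y], _ => exact ⟨6, rfl⟩
  | _ :: _ :: _ :: _, h => simp at h

/-- The row of `U` turns a column relation into a relation multiplied on the left by `U*`, and every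
word of length at most two is such a `U*`. -/
theorem CircleRelations.of_momentMatrix {β : Word → ℝ} (htracial : IsTracial β)
    (hnorm : IsNormalized β)
    (hXY : (momentMatrix β).col 4 + (momentMatrix β).col 5 = 0)
    (hXX : (momentMatrix β).col 3 + (momentMatrix β).col 6 = (momentMatrix β).col 0) :
    CircleRelations β where
  tracial := htracial
  one := hnorm
  anticomm r hr := by
    obtain ⟨i, rfl⟩ := exists_wordsTwo_reverse hr
    exact congrFun hXY i
  circle r hr := by
    obtain ⟨i, rfl⟩ := exists_wordsTwo_reverse hr
    have h : β ((wordsTwo i).reverse ++ [X, X]) + β ((wordsTwo i).reverse ++ [Y, Y]) =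
      β ((wordsTwo i).reverse ++ []) := congrFun hXX i
    rwa [List.append_nil] at h

/-- The value at `w` of the functional satisfying the circle relations with prescribed values
`a, b, p, q` at `X, Y, X², X⁴`. -/
def circleValue (a b p q : ℝ) : Word → ℝ
  | [] => 1
  | [X] => a
  | [Y] => b
  | [X, X] => p
  | [Y, Y] => 1 - p
  | [X, X, X] => a
  | [Y, Y, Y] => b
  | [X, X, X, X] => q
  | [Y, Y, Y, Y] => 1 - 2 * p + q
  | [X, X, Y, Y] => p - q
  | [X, Y, Y, X] => p - q
  | [Y, Y, X, X] => p - q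
  | [Y, X, X, Y] => p - q
  | [X, Y, X, Y] => q - p
  | [Y, X, Y, X] => q - p
  | _ => 0

/-- Cyclic rotations identify words that anticommutation makes opposite, which kills most mixed
moments; the circle relation then expresses the remaining ones. All of this is linear algebra on the
words of length at most four. -/
theorem CircleRelations.eq_circleValue {β : Word → ℝ} (h : CircleRelations β) {w : Word}
    (hw : w.length ≤ 4) :
    β w = circleValue (β [X]) (β [Y]) (β [X, X]) (β [X, X, X, X]) w := by
  have rot (n : ℕ) (v : Word) (hv : v.length ≤ 4) : β v = β (v.rotate n) :=
    h.tracial.1 v _ hv ⟨n, rfl⟩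
  have e0 : β [] = 1 := h.one
  have r1 : β [X, Y] = β [Y, X] := rot 1 [X, Y] (by simp)
  have e1 : β [X, Y] + β [Y, X] = 0 := h.anticomm [] (by simp)
  have e2 : β [X, X] + β [Y, Y] = β [] := h.circle [] (by simp)
  have r2 : β [X, X, Y] = β [X, Y, X] := rot 1 [X, X, Y] (by simp)
  have r3 : β [X, X, Y] = β [Y, X, X] := rot 2 [X, X, Y] (by simp)
  have r4 : β [X, Y, Y] = β [Y, Y, X] := rot 1 [X, Y, Y] (by simp)
  have r5 : β [X, Y, Y] = β [Y, X, Y] := rot 2 [X, Y, Y] (by simp)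
  have e3 : β [X, X, Y] + β [X, Y, X] = 0 := h.anticomm [X] (by simp)
  have e4 : β [Y, X, Y] + β [Y, Y, X] = 0 := h.anticomm [Y] (by simp)
  have e5 : β [X, X, X] + β [X, Y, Y] = β [X] := h.circle [X] (by simp)
  have e6 : β [Y, X, X] + β [Y, Y, Y] = β [Y] := h.circle [Y] (by simp)
  have r6 : β [X, X, X, Y] = β [X, X, Y, X] := rot 1 [X, X, X, Y] (by simp)
  have r7 : β [X, X, X, Y] = β [X, Y, X, X] := rot 2 [X, X, X, Y] (by simp)
  have r8 : β [X, X, X, Y] = β [Y, X, X, X] := rot 3 [X, X, X, Y] (by simp)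
  have r9 : β [X, Y, Y, Y] = β [Y, Y, Y, X] := rot 1 [X, Y, Y, Y] (by simp)
  have r10 : β [X, Y, Y, Y] = β [Y, Y, X, Y] := rot 2 [X, Y, Y, Y] (by simp)
  have r11 : β [X, Y, Y, Y] = β [Y, X, Y, Y] := rot 3 [X, Y, Y, Y] (by simp)
  have r12 : β [X, X, Y, Y] = β [X, Y, Y, X] := rot 1 [X, X, Y, Y] (by simp)
  have r13 : β [X, X, Y, Y] = β [Y, Y, X, X] := rot 2 [X, X, Y, Y] (by simp)
  have r14 : β [X, X, Y, Y] = β [Y, X, X, Y] := rot 3 [X, X, Y, Y] (by simp)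
  have r15 : β [X, Y, X, Y] = β [Y, X, Y, X] := rot 1 [X, Y, X, Y] (by simp)
  have e7 : β [X, X, X, Y] + β [X, X, Y, X] = 0 := h.anticomm [X, X] (by simp)
  have e8 : β [Y, Y, X, Y] + β [Y, Y, Y, X] = 0 := h.anticomm [Y, Y] (by simp)
  have e9 : β [X, Y, X, Y] + β [X, Y, Y, X] = 0 := h.anticomm [X, Y] (by simp)
  have e10 : β [X, X, X, X] + β [X, X, Y, Y] = β [X, X] := h.circle [X, X] (by simp)
  have e11 : β [Y, Y, X, X] + β [Y, Y, Y, Y] = β [Y, Y] := h.circle [Y, Y] (by simp)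
  match w, hw with
  | [], _ => exact e0
  | [l₁], _ => cases l₁ <;> simp only [circleValue]
  | [l₁, l₂], _ => cases l₁ <;> cases l₂ <;> simp only [circleValue] <;> linarith
  | [l₁, l₂, l₃], _ =>
    cases l₁ <;> cases l₂ <;> cases l₃ <;> simp only [circleValue] <;> linarith
  | [l₁, l₂, l₃, l₄], _ =>
    cases l₁ <;> cases l₂ <;> cases l₃ <;> cases l₄ <;> simp only [circleValue] <;> linarith
  | _ :: _ :: _ :: _ :: _ :: _, h => simp at h; omega

theorem CircleRelations.ext {β γ : Word → ℝ} (hβ : CircleRelations β) (hγ : CircleRelations γ)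
    (h₁ : β [X] = γ [X]) (h₂ : β [Y] = γ [Y]) (h₃ : β [X, X] = γ [X, X])
    (h₄ : β [X, X, X, X] = γ [X, X, X, X]) {w : Word} (hw : w.length ≤ 4) : β w = γ w := by
  rw [hβ.eq_circleValue hw, hγ.eq_circleValue hw, h₁, h₂, h₃, h₄]

end Words

/-! ### Atoms of representing measures satisfy the relations -/

section Eval

variable {t : ℕ} (A B : Matrix (Fin t) (Fin t) ℝ)

@[simp] theorem evalWord_nil : evalWord A B [] = 1 := rfl

@[simp] theorem evalWord_cons_X (w : Word) : evalWord A B (X :: w) = A * evalWord A B w := rfl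

@[simp] theorem evalWord_cons_Y (w : Word) : evalWord A B (Y :: w) = B * evalWord A B w := rfl

theorem evalWord_append (v w : Word) :
    evalWord A B (v ++ w) = evalWord A B v * evalWord A B w := by
  simp [evalWord]

variable {A B}

theorem evalWord_reverse (hA : A.IsSymm) (hB : B.IsSymm) (w : Word) :
    evalWord A B w.reverse = (evalWord A B w)ᵀ := by
  induction w with
  | nil => simp
  | cons l w ih =>
    cases l <;> simp [evalWord_append, ih, hA.eq, hB.eq, transpose_mul]

end Eval

namespace AtomicMeasure

/-- Every atom satisfies `AB + BA = 0` and `A² + B² = 1`. -/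
structure IsCircular (μ : AtomicMeasure) : Prop where
  anticomm : ∀ i, μ.atomX i * μ.atomY i + μ.atomY i * μ.atomX i = 0
  circle : ∀ i, μ.atomX i * μ.atomX i + μ.atomY i * μ.atomY i = 1

theorem size_inv_pos (μ : AtomicMeasure) (i : Fin μ.N) : 0 < (μ.size i : ℝ)⁻¹ := by
  have := μ.size_pos i
  positivity

theorem moment_nil (μ : AtomicMeasure) : μ.moment [] = 1 := by
  rw [moment, ← μ.sum_density]
  refine Finset.sum_congr rfl fun i _ => ?_
  have := μ.size_pos i
  simp [this.ne']

theorem isTracial_moment (μ : AtomicMeasure) : IsTracial μ.moment := by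
  constructor
  · rintro v w - ⟨n, rfl⟩
    refine Finset.sum_congr rfl fun i _ => ?_
    rw [List.rotate_eq_drop_append_take_mod, evalWord_append, trace_mul_comm, ← evalWord_append,
      List.take_append_drop]
  · intro w _
    refine Finset.sum_congr rfl fun i _ => ?_
    rw [evalWord_reverse (μ.symmX i) (μ.symmY i), trace_transpose]

theorem IsCircular.circleRelations {μ : AtomicMeasure} (h : μ.IsCircular) :
    CircleRelations μ.moment where
  tracial := μ.isTracial_moment
  one := μ.moment_nil
  anticomm r _ := by
    rw [moment, moment, ← Finset.sum_add_distrib]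
    refine Finset.sum_eq_zero fun i _ => ?_
    rw [← mul_add, ← mul_add, ← trace_add, evalWord_append, evalWord_append, ← mul_add]
    simp [h.anticomm i]
  circle r _ := by
    simp only [moment]
    rw [← Finset.sum_add_distrib]
    refine Finset.sum_congr rfl fun i _ => ?_
    rw [← mul_add, ← mul_add, ← trace_add, evalWord_append, evalWord_append, ← mul_add]
    simp [h.circle i]

end AtomicMeasure

theorem trace_mul_self_eq_sum_sq {t : ℕ} {M : Matrix (Fin t) (Fin t) ℝ} (hM : M.IsSymm) :
    (M * M).trace = ∑ i, ∑ j, M i j ^ 2 := by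
  simp only [trace, diag_apply, mul_apply]
  refine Finset.sum_congr rfl fun i _ => Finset.sum_congr rfl fun j _ => ?_
  rw [hM.apply i j, sq]

theorem trace_mul_self_nonneg {t : ℕ} {M : Matrix (Fin t) (Fin t) ℝ} (hM : M.IsSymm) :
    0 ≤ (M * M).trace := by
  rw [trace_mul_self_eq_sum_sq hM]
  positivity

theorem eq_zero_of_trace_mul_self_eq_zero {t : ℕ} {M : Matrix (Fin t) (Fin t) ℝ}
    (hM : M.IsSymm) (h : (M * M).trace = 0) : M = 0 := by
  rw [trace_mul_self_eq_sum_sq hM, Finset.sum_eq_zero_iff_of_nonneg (by intros; positivity)] at h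
  ext i j
  have := h i (Finset.mem_univ i)
  rw [Finset.sum_eq_zero_iff_of_nonneg (by intros; positivity)] at this
  exact pow_eq_zero_iff two_ne_zero |>.1 (this j (Finset.mem_univ j))

namespace AtomicMeasure

theorem eq_zero_of_sum_trace_mul_self_eq_zero (μ : AtomicMeasure)
    {M : ∀ i, Matrix (Fin (μ.size i)) (Fin (μ.size i)) ℝ} (hM : ∀ i, (M i).IsSymm)
    (h : ∑ i, μ.density i * ((μ.size i : ℝ)⁻¹ * (M i * M i).trace) = 0) (i : Fin μ.N) :
    M i = 0 := by
  have pos (i) : 0 ≤ μ.density i * ((μ.size i : ℝ)⁻¹ * (M i * M i).trace) :=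
    mul_nonneg (μ.density_pos i).le (mul_nonneg (μ.size_inv_pos i).le (trace_mul_self_nonneg (hM i)))
  rw [Finset.sum_eq_zero_iff_of_nonneg fun i _ => pos i] at h
  have := h i (Finset.mem_univ i)
  simp only [mul_eq_zero, (μ.density_pos i).ne', (μ.size_inv_pos i).ne', false_or] at this
  exact eq_zero_of_trace_mul_self_eq_zero (hM i) this

/-- Both defects `AB + BA` and `A² + B² - 1` are symmetric, and their squares have degree four, so
the mean of the normalized traces of these squares is visible to `β` and equals zero. Positivity of
`tr M²` forces each defect to vanish. -/
theorem Represents.isCircular {μ : AtomicMeasure} {β : Word → ℝ} (hμ : μ.Represents β)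
    (hβ : CircleRelations β) : μ.IsCircular := by
  constructor
  · refine μ.eq_zero_of_sum_trace_mul_self_eq_zero (fun i => ?_) ?_
    · simp only [IsSymm, transpose_add, transpose_mul, (μ.symmX i).eq, (μ.symmY i).eq]
      rw [add_comm]
    · have e : (β [X, Y, X, Y] + β [X, Y, Y, X]) + (β [Y, X, X, Y] + β [Y, X, Y, X]) = 0 := by
        have e1 : β [X, Y, X, Y] + β [X, Y, Y, X] = 0 := hβ.anticomm [X, Y] (by simp)
        have e2 : β [Y, X, X, Y] + β [Y, X, Y, X] = 0 := hβ.anticomm [Y, X] (by simp)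
        rw [e1, e2, add_zero]
      rw [hμ _ (by simp), hμ _ (by simp), hμ _ (by simp), hμ _ (by simp)] at e
      simp only [moment, ← Finset.sum_add_distrib] at e
      rw [← e]
      refine Finset.sum_congr rfl fun i _ => ?_
      simp only [evalWord_cons_X, evalWord_cons_Y, evalWord_nil, mul_one, ← mul_add, ← trace_add]
      congr 3
      noncomm_ring
  · intro i
    rw [← sub_eq_zero]
    revert i
    refine μ.eq_zero_of_sum_trace_mul_self_eq_zero (fun i => ?_) ?_
    · simp only [IsSymm, transpose_add, transpose_sub, transpose_mul, (μ.symmX i).eq,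
        (μ.symmY i).eq, transpose_one]
    · have e : ((β [X, X, X, X] + β [X, X, Y, Y] - β [X, X]) +
          (β [Y, Y, X, X] + β [Y, Y, Y, Y] - β [Y, Y])) - (β [X, X] + β [Y, Y] - β []) = 0 := by
        have e1 : β [X, X, X, X] + β [X, X, Y, Y] = β [X, X] := hβ.circle [X, X] (by simp)
        have e2 : β [Y, Y, X, X] + β [Y, Y, Y, Y] = β [Y, Y] := hβ.circle [Y, Y] (by simp)
        have e3 : β [X, X] + β [Y, Y] = β [] := hβ.circle [] (by simp)
        linarith
      rw [hμ [X, X, X, X] (by simp), hμ [X, X, Y, Y] (by simp), hμ [X, X] (by simp),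
        hμ [Y, Y, X, X] (by simp), hμ [Y, Y, Y, Y] (by simp), hμ [Y, Y] (by simp),
        hμ [] (by simp)] at e
      simp only [moment, ← Finset.sum_add_distrib, ← Finset.sum_sub_distrib] at e
      rw [← e]
      refine Finset.sum_congr rfl fun i _ => ?_
      simp only [evalWord_cons_X, evalWord_cons_Y, evalWord_nil, mul_one, ← mul_add, ← mul_sub,
        ← trace_add, ← trace_sub]
      congr 3
      noncomm_ring

theorem IsCircular.represents {μ : AtomicMeasure} {β : Word → ℝ} (hμ : μ.IsCircular)
    (hβ : CircleRelations β) (h₁ : μ.moment [X] = β [X]) (h₂ : μ.moment [Y] = β [Y])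
    (h₃ : μ.moment [X, X] = β [X, X]) (h₄ : μ.moment [X, X, X, X] = β [X, X, X, X]) :
    μ.Represents β :=
  fun _ hw => hβ.ext hμ.circleRelations h₁.symm h₂.symm h₃.symm h₄.symm hw

end AtomicMeasure

/-! ### Symmetric pairs with `AB + BA = 0` and `A² + B² = 1` -/

section LinearAlgebra

variable {t : ℕ} {A B : Matrix (Fin t) (Fin t) ℝ}

theorem exists_orthogonal_diagonalization (hA : A.IsSymm) :
    ∃ (U : Matrix (Fin t) (Fin t) ℝ) (x : Fin t → ℝ), U * Uᵀ = 1 ∧ Uᵀ * U = 1 ∧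
      A = U * diagonal x * Uᵀ := by
  have hH : A.IsHermitian := by rwa [IsHermitian, conjTranspose_eq_transpose_of_trivial]
  have hstar : star (hH.eigenvectorUnitary : Matrix (Fin t) (Fin t) ℝ) =
      (hH.eigenvectorUnitary : Matrix (Fin t) (Fin t) ℝ)ᵀ := by
    rw [star_eq_conjTranspose, conjTranspose_eq_transpose_of_trivial]
  refine ⟨hH.eigenvectorUnitary, hH.eigenvalues, ?_, ?_, ?_⟩
  · rw [← hstar]
    exact Unitary.mul_star_self_of_mem hH.eigenvectorUnitary.2
  · rw [← hstar]
    exact Unitary.star_mul_self_of_mem hH.eigenvectorUnitary.2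
  · rw [← hstar]
    exact hH.spectral_theorem

theorem conj_mul_conj {m n : ℕ} {U : Matrix (Fin m) (Fin n) ℝ} (hU : Uᵀ * U = 1)
    (M N : Matrix (Fin n) (Fin n) ℝ) : U * M * Uᵀ * (U * N * Uᵀ) = U * (M * N) * Uᵀ := by
  calc U * M * Uᵀ * (U * N * Uᵀ) = U * M * (Uᵀ * U) * N * Uᵀ := by simp only [Matrix.mul_assoc]
    _ = U * (M * N) * Uᵀ := by rw [hU, Matrix.mul_one]; simp only [Matrix.mul_assoc]

theorem trace_conj {m n : ℕ} {U : Matrix (Fin m) (Fin n) ℝ} (hU : Uᵀ * U = 1)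
    (M : Matrix (Fin n) (Fin n) ℝ) : (U * M * Uᵀ).trace = M.trace := by
  rw [Matrix.trace_mul_comm, ← Matrix.mul_assoc, hU, Matrix.one_mul]

theorem conj_pow {U : Matrix (Fin t) (Fin t) ℝ} (hU : U * Uᵀ = 1) (hU' : Uᵀ * U = 1)
    (M : Matrix (Fin t) (Fin t) ℝ) (k : ℕ) : (U * M * Uᵀ) ^ k = U * M ^ k * Uᵀ := by
  induction k with
  | zero => simp [hU]
  | succ k ih => rw [pow_succ, ih, conj_mul_conj hU', pow_succ]

theorem trace_conj_diagonal_pow {U : Matrix (Fin t) (Fin t) ℝ} (hU : U * Uᵀ = 1)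
    (hU' : Uᵀ * U = 1) (x : Fin t → ℝ) (k : ℕ) :
    ((U * diagonal x * Uᵀ) ^ k).trace = ∑ i, x i ^ k := by
  rw [conj_pow hU hU', trace_conj hU', diagonal_pow, trace_diagonal]
  rfl

/-- Odd powers of `A` anticommute with `B`, so `tr (A^(2k+1) B²)` equals its own negative;
substituting `A² = 1 - B²` lowers the exponent by two without changing the trace. -/
theorem trace_pow_odd (hanti : A * B + B * A = 0) (hcirc : A * A + B * B = 1) (k : ℕ) :
    (A ^ (2 * k + 1)).trace = A.trace := by
  have h1 : A * B = -(B * A) := eq_neg_of_add_eq_zero_left hanti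
  have h2 : Commute (A * A) B := by
    change A * A * B = B * (A * A)
    rw [mul_assoc, h1, mul_neg, ← mul_assoc, h1, neg_mul, neg_neg, mul_assoc]
  have h3 (k : ℕ) : A ^ (2 * k + 1) * B = -(B * A ^ (2 * k + 1)) := by
    have := (h2.pow_left k).eq
    rw [← sq, ← pow_mul] at this
    rw [pow_succ, mul_assoc, h1, mul_neg, ← mul_assoc, this, mul_assoc]
  have h4 (k : ℕ) : (A ^ (2 * k + 1) * B * B).trace = 0 := by
    have e : (A ^ (2 * k + 1) * B * B).trace = -(A ^ (2 * k + 1) * B * B).trace := by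
      conv_lhs => rw [h3, neg_mul, trace_neg, mul_assoc, trace_mul_comm]
    linarith
  induction k with
  | zero => simp
  | succ k ih =>
    have e : A ^ (2 * (k + 1) + 1) = A ^ (2 * k + 1) - A ^ (2 * k + 1) * B * B := by
      rw [show 2 * (k + 1) + 1 = (2 * k + 1) + 1 + 1 by ring, pow_succ, pow_succ _ (2 * k + 1),
        mul_assoc, mul_assoc, eq_sub_of_add_eq hcirc, mul_sub, mul_one]
    rw [e, trace_sub, h4, sub_zero, ih]

/-- In an eigenbasis of `A`, `1 - A²` becomes the Gram matrix of `B U`, whose diagonal is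
nonnegative. -/
theorem sq_le_one_of_circle {U : Matrix (Fin t) (Fin t) ℝ} {x : Fin t → ℝ} (hB : B.IsSymm)
    (hU' : Uᵀ * U = 1) (hAU : A = U * diagonal x * Uᵀ)
    (hcirc : A * A + B * B = 1) (i : Fin t) : x i ^ 2 ≤ 1 := by
  have e : (B * U)ᵀ * (B * U) = 1 - diagonal (fun i => x i ^ 2) := by
    calc (B * U)ᵀ * (B * U) = Uᵀ * (B * B) * U := by
          rw [transpose_mul, hB.eq]; simp only [Matrix.mul_assoc]
      _ = Uᵀ * U - (Uᵀ * U) * (diagonal x * (Uᵀ * U) * diagonal x) * (Uᵀ * U) := by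
          rw [eq_sub_of_add_eq' hcirc, hAU, Matrix.mul_sub, Matrix.sub_mul, Matrix.mul_one]
          simp only [Matrix.mul_assoc]
      _ = 1 - diagonal (fun i => x i ^ 2) := by
          rw [hU', Matrix.mul_one, Matrix.mul_one, Matrix.one_mul, diagonal_mul_diagonal]
          simp only [sq]
  have h := congrFun (congrFun e i) i
  rw [Matrix.sub_apply, one_apply_eq, diagonal_apply_eq, mul_apply] at h
  have : 0 ≤ ∑ j, (B * U)ᵀ i j * (B * U) j i :=
    Finset.sum_nonneg fun j _ => by rw [transpose_apply]; exact mul_self_nonneg _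
  linarith

theorem abs_trace_le_trace_pow_even (hA : A.IsSymm) (hB : B.IsSymm)
    (hanti : A * B + B * A = 0) (hcirc : A * A + B * B = 1) (k : ℕ) :
    |A.trace| ≤ (A ^ (2 * k)).trace := by
  obtain ⟨U, x, hU, hU', hAU⟩ := exists_orthogonal_diagonalization hA
  have hx := sq_le_one_of_circle hB hU' hAU hcirc
  rw [← trace_pow_odd hanti hcirc k, hAU, trace_conj_diagonal_pow hU hU',
    trace_conj_diagonal_pow hU hU']
  refine (Finset.abs_sum_le_sum_abs _ _).trans (Finset.sum_le_sum fun i _ => ?_)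
  have h1 : |x i| ≤ 1 := by rw [← sq_le_one_iff_abs_le_one]; exact hx i
  rw [abs_pow, pow_succ, pow_mul, sq_abs, ← pow_mul]
  exact mul_le_of_le_one_right (by rw [pow_mul]; positivity) h1

open Filter Topology in
theorem tendsto_sum_pow_indicator {ι : Type*} [Fintype ι] {y : ι → ℝ} (h0 : ∀ i, 0 ≤ y i)
    (h1 : ∀ i, y i ≤ 1) :
    Tendsto (fun k : ℕ => ∑ i, y i ^ k) atTop (𝓝 (∑ i, if y i = 1 then (1 : ℝ) else 0)) := by
  refine tendsto_finsetSum _ fun i _ => ?_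
  split_ifs with h
  · exact tendsto_const_nhds.congr fun k => by rw [h, one_pow]
  · exact tendsto_pow_atTop_nhds_zero_of_lt_one (h0 i) (lt_of_le_of_ne (h1 i) h)

/-- The spectrum of the first matrix controls the traces of both matrices of a pair with
`AB + BA = 0` and `A² + B² = 1`. -/
theorem exists_spectrum_of_circle (hA : A.IsSymm) (hB : B.IsSymm)
    (hanti : A * B + B * A = 0) (hcirc : A * A + B * B = 1) :
    ∃ x : Fin t → ℝ, (∀ i, x i ^ 2 ≤ 1) ∧ (∀ k, (A ^ k).trace = ∑ i, x i ^ k) ∧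
      |A.trace| ≤ ∑ i, (if x i ^ 2 = 1 then (1 : ℝ) else 0) ∧
      |B.trace| ≤ ∑ i, (if 1 - x i ^ 2 = 1 then (1 : ℝ) else 0) := by
  obtain ⟨U, x, hU, hU', hAU⟩ := exists_orthogonal_diagonalization hA
  have hx := sq_le_one_of_circle hB hU' hAU hcirc
  have htr (k : ℕ) : (A ^ k).trace = ∑ i, x i ^ k := by
    rw [hAU, trace_conj_diagonal_pow hU hU']
  refine ⟨x, hx, htr, ?_, ?_⟩
  -- The bound `|tr A| ≤ tr A^(2k)` holds for every `k`; in the limit only the eigenvalues `±1`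
  -- survive.
  · refine ge_of_tendsto' (tendsto_sum_pow_indicator (fun i => sq_nonneg (x i)) hx) fun k => ?_
    simp only [← pow_mul]
    rw [← htr]
    exact abs_trace_le_trace_pow_even hA hB hanti hcirc k
  · refine ge_of_tendsto' (tendsto_sum_pow_indicator (y := fun i => 1 - x i ^ 2)
      (fun i => sub_nonneg.2 (hx i)) fun i => sub_le_self _ (sq_nonneg _)) fun k => ?_
    -- `B` need not be diagonal in this basis, but `B² = 1 - A²` is, so the same limit applies with
    -- the roles exchanged.
    have e : B ^ 2 = U * diagonal (fun i => 1 - x i ^ 2) * Uᵀ := by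
      rw [sq, eq_sub_of_add_eq' hcirc, hAU, conj_mul_conj hU', diagonal_mul_diagonal]
      have : diagonal (fun i => 1 - x i ^ 2) = 1 - diagonal (fun i => x i * x i) := by
        rw [← diagonal_one, diagonal_sub]
        simp only [sq]
      rw [this, Matrix.mul_sub, Matrix.sub_mul, Matrix.mul_one, hU]
    rw [← trace_conj_diagonal_pow hU hU', ← e, ← pow_mul]
    exact abs_trace_le_trace_pow_even hB hA (by rw [add_comm]; exact hanti)
      (by rw [add_comm]; exact hcirc) k

/-- The first matrix of the normal form of an irreducible pair. -/
noncomputable def normalX (s : ℝ) : Matrix (Fin 2) (Fin 2) ℝ := !![√s, 0; 0, -√s]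

/-- The second matrix of the normal form of an irreducible pair. -/
noncomputable def normalY (s : ℝ) : Matrix (Fin 2) (Fin 2) ℝ := !![0, √(1 - s); √(1 - s), 0]

/-- Swapping the basis vectors changes the sign of `x` only, and reflecting one of them changes the
sign of `f` only. -/
theorem exists_orthogonal_normalize_signs {x f : ℝ} (hx : x ≠ 0) (hf : f ≠ 0)
    (hxf : x ^ 2 + f ^ 2 = 1) :
    ∃ W : Matrix (Fin 2) (Fin 2) ℝ, W * Wᵀ = 1 ∧ Wᵀ * W = 1 ∧
      !![x, 0; 0, -x] = W * normalX (x ^ 2) * Wᵀ ∧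
      !![0, f; f, 0] = W * normalY (x ^ 2) * Wᵀ := by
  have e1 : √(x ^ 2) = |x| := Real.sqrt_sq_eq_abs x
  have e2 : √(1 - x ^ 2) = |f| := by rw [← hxf, add_sub_cancel_left, Real.sqrt_sq_eq_abs]
  rw [normalX, normalY, e1, e2]
  rcases lt_or_gt_of_ne hx with h | h <;> rcases lt_or_gt_of_ne hf with h' | h'
  · refine ⟨!![0, 1; -1, 0], ?_, ?_, ?_, ?_⟩ <;> ext i j <;> fin_cases i <;> fin_cases j <;>
      simp [mul_apply, abs_of_neg h, abs_of_neg h']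
  · refine ⟨!![0, 1; 1, 0], ?_, ?_, ?_, ?_⟩ <;> ext i j <;> fin_cases i <;> fin_cases j <;>
      simp [mul_apply, abs_of_neg h, abs_of_pos h']
  · refine ⟨!![1, 0; 0, -1], ?_, ?_, ?_, ?_⟩ <;> ext i j <;> fin_cases i <;> fin_cases j <;>
      simp [mul_apply, abs_of_pos h, abs_of_neg h']
  · refine ⟨1, ?_, ?_, ?_, ?_⟩ <;> simp [abs_of_pos h, abs_of_pos h']

/-- In an eigenbasis of `A`, anticommutation reads `(x i + x j) C i j = 0`. As `AB ≠ 0`, the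
off-diagonal entry of `C` cannot vanish, so the eigenvalues are opposite and nonzero, and then the
diagonal of `C` is zero. -/
theorem exists_orthogonal_normal_form {A B : Matrix (Fin 2) (Fin 2) ℝ} (hA : A.IsSymm)
    (hB : B.IsSymm) (hanti : A * B + B * A = 0) (hcirc : A * A + B * B = 1)
    (hne : A * B ≠ 0) :
    ∃ s : ℝ, 0 < s ∧ s < 1 ∧ ∃ U : Matrix (Fin 2) (Fin 2) ℝ, U * Uᵀ = 1 ∧ Uᵀ * U = 1 ∧
      A = U * normalX s * Uᵀ ∧ B = U * normalY s * Uᵀ := by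
  obtain ⟨V, x, hV, hV', hAV⟩ := exists_orthogonal_diagonalization hA
  obtain ⟨C, hC, hBC⟩ : ∃ C : Matrix (Fin 2) (Fin 2) ℝ, C.IsSymm ∧ B = V * C * Vᵀ := by
    refine ⟨Vᵀ * B * V, ?_, ?_⟩
    · simp only [IsSymm, transpose_mul, transpose_transpose, hB.eq, Matrix.mul_assoc]
    · calc B = (V * Vᵀ) * B * (V * Vᵀ) := by rw [hV, Matrix.one_mul, Matrix.mul_one]
        _ = _ := by simp only [Matrix.mul_assoc]
  have inj {M N : Matrix (Fin 2) (Fin 2) ℝ} (h : V * M * Vᵀ = V * N * Vᵀ) : M = N := by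
    have h := congrArg (fun K => Vᵀ * K * V) h
    have e (K : Matrix (Fin 2) (Fin 2) ℝ) : Vᵀ * (V * K * Vᵀ) * V = K := by
      calc Vᵀ * (V * K * Vᵀ) * V = (Vᵀ * V) * K * (Vᵀ * V) := by simp only [Matrix.mul_assoc]
        _ = K := by rw [hV', Matrix.one_mul, Matrix.mul_one]
    simpa only [e] using h
  have hanti' : diagonal x * C + C * diagonal x = 0 := by
    apply inj
    rw [Matrix.mul_add, Matrix.add_mul, ← conj_mul_conj hV', ← conj_mul_conj hV', ← hAV, ← hBC,
      hanti]
    simp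
  have hcirc' : diagonal x * diagonal x + C * C = 1 := by
    apply inj
    rw [Matrix.mul_add, Matrix.add_mul, ← conj_mul_conj hV', ← conj_mul_conj hV', ← hAV, ← hBC,
      hcirc]
    simp [hV]
  have hne' : diagonal x * C ≠ 0 := by
    intro h
    apply hne
    rw [hAV, hBC, conj_mul_conj hV', h]
    simp
  have h10 : C 1 0 = C 0 1 := hC.apply 0 1
  have a00 := congrFun (congrFun hanti' 0) 0
  have a01 := congrFun (congrFun hanti' 0) 1
  have a11 := congrFun (congrFun hanti' 1) 1
  have c00 := congrFun (congrFun hcirc' 0) 0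
  simp only [Matrix.add_apply, diagonal_mul, mul_diagonal, Matrix.zero_apply] at a00 a01 a11
  simp only [Matrix.add_apply, diagonal_mul, diagonal_apply_eq, one_apply_eq, Matrix.mul_apply (M := C),
    Fin.sum_univ_two, h10] at c00
  have hf : C 0 1 ≠ 0 := by
    intro h
    apply hne'
    have h0 : x 0 * C 0 0 = 0 := by linarith
    have h1 : x 1 * C 1 1 = 0 := by linarith
    ext i j
    rw [diagonal_mul, Matrix.zero_apply]
    fin_cases i <;> fin_cases j
    · exact h0
    · exact mul_eq_zero_of_right _ h
    · exact mul_eq_zero_of_right _ (h10.trans h)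
    · exact h1
  have hx1 : x 1 = -x 0 := by
    have : (x 0 + x 1) * C 0 1 = 0 := by linarith
    have := (mul_eq_zero.1 this).resolve_right hf
    linarith
  have hx0 : x 0 ≠ 0 := by
    intro h
    apply hne'
    ext i j
    fin_cases i <;> fin_cases j <;> simp [diagonal_mul, hx1, h]
  have h00 : C 0 0 = 0 := by
    have : x 0 * C 0 0 = 0 := by linarith
    exact (mul_eq_zero.1 this).resolve_left hx0
  have h11 : C 1 1 = 0 := by
    have : x 0 * C 1 1 = 0 := by rw [hx1] at a11; linarith
    exact (mul_eq_zero.1 this).resolve_left hx0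
  have hxf : x 0 ^ 2 + C 0 1 ^ 2 = 1 := by rw [h00] at c00; linarith
  obtain ⟨W, hW, hW', hWX, hWY⟩ := exists_orthogonal_normalize_signs hx0 hf hxf
  have hD : diagonal x = !![x 0, 0; 0, -x 0] := by
    ext i j
    fin_cases i <;> fin_cases j <;> simp [hx1]
  have hC' : C = !![0, C 0 1; C 0 1, 0] := by
    ext i j
    fin_cases i <;> fin_cases j <;> simp [h00, h11, h10]
  refine ⟨x 0 ^ 2, by positivity, by nlinarith [sq_pos_of_ne_zero hf], V * W, ?_, ?_, ?_, ?_⟩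
  · rw [transpose_mul]
    calc V * W * (Wᵀ * Vᵀ) = V * (W * Wᵀ) * Vᵀ := by simp only [Matrix.mul_assoc]
      _ = 1 := by rw [hW, Matrix.mul_one, hV]
  · rw [transpose_mul]
    calc Wᵀ * Vᵀ * (V * W) = Wᵀ * (Vᵀ * V) * W := by simp only [Matrix.mul_assoc]
      _ = 1 := by rw [hV', Matrix.mul_one, hW']
  · rw [hAV, hD, hWX, transpose_mul]
    simp only [Matrix.mul_assoc]
  · rw [hBC, hC', hWY, transpose_mul]
    simp only [Matrix.mul_assoc]

end LinearAlgebra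

/-! ### Necessary inequalities between the moments -/

namespace AtomicMeasure

theorem abs_sum_trace_le (μ : AtomicMeasure)
    (M : ∀ i, Matrix (Fin (μ.size i)) (Fin (μ.size i)) ℝ) :
    |∑ i, μ.density i * ((μ.size i : ℝ)⁻¹ * (M i).trace)| ≤
      ∑ i, μ.density i * ((μ.size i : ℝ)⁻¹ * |(M i).trace|) := by
  refine (Finset.abs_sum_le_sum_abs _ _).trans (Finset.sum_le_sum fun i _ => ?_)
  rw [abs_mul, abs_mul, abs_of_pos (μ.density_pos i), abs_of_pos (μ.size_inv_pos i)]

/-- A quadratic polynomial on `[0, 1]` dominating a combination of the indicators of `1` and `0`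
yields an inequality between the moments of `X, Y, X², X⁴`. -/
theorem IsCircular.abs_moment_le {μ : AtomicMeasure} (hμ : μ.IsCircular) {α γ k₀ k₁ k₂ : ℝ}
    (hα : 0 ≤ α) (hγ : 0 ≤ γ)
    (h : ∀ y : ℝ, 0 ≤ y → y ≤ 1 →
      α * (if y = 1 then 1 else 0) + γ * (if 1 - y = 1 then 1 else 0) ≤
        k₀ + k₁ * y + k₂ * y ^ 2) :
    α * |μ.moment [X]| + γ * |μ.moment [Y]| ≤
      k₀ + k₁ * μ.moment [X, X] + k₂ * μ.moment [X, X, X, X] := by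
  have key (i) : α * |(μ.atomX i).trace| + γ * |(μ.atomY i).trace| ≤
      k₀ * μ.size i + k₁ * (μ.atomX i ^ 2).trace + k₂ * (μ.atomX i ^ 4).trace := by
    obtain ⟨x, hx, htr, hX, hY⟩ := exists_spectrum_of_circle (μ.symmX i) (μ.symmY i)
      (hμ.anticomm i) (hμ.circle i)
    -- The scalar inequality is summed over the eigenvalues `x j ^ 2` of `A²`.
    have hsum := Finset.sum_le_sum fun (j : Fin (μ.size i)) (_ : j ∈ Finset.univ) =>
      h (x j ^ 2) (sq_nonneg _) (hx j)
    simp only [Finset.sum_add_distrib, ← Finset.mul_sum, Finset.sum_const, Finset.card_univ,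
      Fintype.card_fin, nsmul_eq_mul, ← pow_mul] at hsum
    rw [htr, htr]
    have h1 := mul_le_mul_of_nonneg_left hX hα
    have h2 := mul_le_mul_of_nonneg_left hY hγ
    norm_num at hsum
    norm_num at h1 h2
    linarith
  have hsum : ∑ i, μ.density i * ((μ.size i : ℝ)⁻¹ *
        (α * |(μ.atomX i).trace| + γ * |(μ.atomY i).trace|)) ≤
      ∑ i, μ.density i * ((μ.size i : ℝ)⁻¹ *
        (k₀ * μ.size i + k₁ * (μ.atomX i ^ 2).trace + k₂ * (μ.atomX i ^ 4).trace)) :=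
    Finset.sum_le_sum fun i _ => mul_le_mul_of_nonneg_left
      (mul_le_mul_of_nonneg_left (key i) (μ.size_inv_pos i).le) (μ.density_pos i).le
  have hX : |μ.moment [X]| ≤ _ := μ.abs_sum_trace_le fun i => evalWord (μ.atomX i) (μ.atomY i) [X]
  have hY : |μ.moment [Y]| ≤ _ := μ.abs_sum_trace_le fun i => evalWord (μ.atomX i) (μ.atomY i) [Y]
  have hR : ∑ i, μ.density i * ((μ.size i : ℝ)⁻¹ *
        (k₀ * μ.size i + k₁ * (μ.atomX i ^ 2).trace + k₂ * (μ.atomX i ^ 4).trace)) =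
      k₀ + k₁ * μ.moment [X, X] + k₂ * μ.moment [X, X, X, X] := by
    have hk : k₀ = ∑ i, k₀ * μ.density i := by rw [← Finset.mul_sum, μ.sum_density, mul_one]
    conv_rhs => rw [hk]
    simp only [moment, Finset.mul_sum, ← Finset.sum_add_distrib]
    refine Finset.sum_congr rfl fun i _ => ?_
    have := μ.size_pos i
    have e2 : evalWord (μ.atomX i) (μ.atomY i) [X, X] = μ.atomX i ^ 2 := by
      simp [sq]
    have e4 : evalWord (μ.atomX i) (μ.atomY i) [X, X, X, X] = μ.atomX i ^ 4 := by
      simp only [evalWord_cons_X, evalWord_nil, mul_one]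
      noncomm_ring
    rw [e2, e4]
    field_simp
  have hL : ∑ i, μ.density i * ((μ.size i : ℝ)⁻¹ *
        (α * |(μ.atomX i).trace| + γ * |(μ.atomY i).trace|)) =
      α * (∑ i, μ.density i * ((μ.size i : ℝ)⁻¹ * |(μ.atomX i).trace|)) +
        γ * (∑ i, μ.density i * ((μ.size i : ℝ)⁻¹ * |(μ.atomY i).trace|)) := by
    simp only [Finset.mul_sum, ← Finset.sum_add_distrib]
    exact Finset.sum_congr rfl fun i _ => by ring
  simp only [evalWord_cons_X, evalWord_cons_Y, evalWord_nil, mul_one] at hX hY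
  rw [hL, hR] at hsum
  exact (add_le_add (mul_le_mul_of_nonneg_left hX hα) (mul_le_mul_of_nonneg_left hY hγ)).trans hsum

theorem IsCircular.moment_fourth_le {μ : AtomicMeasure} (hμ : μ.IsCircular) :
    μ.moment [X, X, X, X] ≤ μ.moment [X, X] := by
  have := hμ.abs_moment_le (α := 0) (γ := 0) (k₀ := 0) (k₁ := 1) (k₂ := -1) le_rfl le_rfl
    fun y h0 h1 => by nlinarith
  linarith

theorem IsCircular.abs_moment_X_le {μ : AtomicMeasure} (hμ : μ.IsCircular) :
    |μ.moment [X]| ≤ μ.moment [X, X, X, X] := by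
  have := hμ.abs_moment_le (α := 1) (γ := 0) (k₀ := 0) (k₁ := 0) (k₂ := 1) zero_le_one le_rfl
    fun y h0 h1 => by
      rw [one_mul, zero_mul]
      split_ifs with h
      · rw [h]; norm_num
      · nlinarith
  linarith

theorem IsCircular.abs_moment_Y_le {μ : AtomicMeasure} (hμ : μ.IsCircular) :
    |μ.moment [Y]| ≤ 1 - 2 * μ.moment [X, X] + μ.moment [X, X, X, X] := by
  have := hμ.abs_moment_le (α := 0) (γ := 1) (k₀ := 1) (k₁ := -2) (k₂ := 1) le_rfl zero_le_one
    fun y h0 h1 => by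
      rw [one_mul, zero_mul]
      split_ifs with h
      · have : y = 0 := by linarith
        rw [this]; norm_num
      · nlinarith [sq_nonneg (1 - y)]
  linarith

/-- The majorant is the square `(y - (1 - θ))²`, which takes exactly the weights `(1 - θ)²` and `θ²`
at `y = 0` and `y = 1`. -/
theorem IsCircular.weighted_moment_le {μ : AtomicMeasure} (hμ : μ.IsCircular) (θ : ℝ) :
    θ ^ 2 * |μ.moment [X]| + (1 - θ) ^ 2 * |μ.moment [Y]| ≤
      θ ^ 2 * μ.moment [X, X] + (1 - θ) ^ 2 * (1 - μ.moment [X, X]) -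
        (μ.moment [X, X] - μ.moment [X, X, X, X]) := by
  have := hμ.abs_moment_le (α := θ ^ 2) (γ := (1 - θ) ^ 2) (k₀ := (1 - θ) ^ 2)
    (k₁ := θ ^ 2 - (1 - θ) ^ 2 - 1) (k₂ := 1) (sq_nonneg _) (sq_nonneg _)
    fun y h0 h1 => by
      split_ifs with h h' h'
      · linarith
      · rw [h]; linarith
      · have : y = 0 := by linarith
        rw [this]; linarith
      · nlinarith [sq_nonneg (y - (1 - θ))]
  linarith

end AtomicMeasure

/-- The pairs `(P, Q)` parametrizing the representing measures with a single atom of size two, of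
density `P + Q` and with `A² = P / (P + Q)`, among those with moments `a, b, p` at `X, Y, X²`
and `d` at `X²Y²`. -/
structure Feasible (a b p d P Q : ℝ) : Prop where
  P_pos : 0 < P
  Q_pos : 0 < Q
  P_le : P ≤ p - |a|
  Q_le : Q ≤ 1 - p - |b|
  curve : P * Q = d * (P + Q)

theorem AtomicMeasure.Represents.necessary {μ : AtomicMeasure} {β : Word → ℝ}
    (hμ : μ.Represents β) (hβ : CircleRelations β) (hne : β [X, X, X, X] ≠ β [X, X]) :
    0 < β [X, X] - β [X, X, X, X] ∧ 0 < β [X, X] - |β [X]| ∧ 0 < 1 - β [X, X] - |β [Y]| ∧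
      (β [X, X] - β [X, X, X, X]) * ((β [X, X] - |β [X]|) + (1 - β [X, X] - |β [Y]|)) ≤
        (β [X, X] - |β [X]|) * (1 - β [X, X] - |β [Y]|) := by
  have hc := hμ.isCircular hβ
  have h1 := hc.moment_fourth_le
  have h2 := hc.abs_moment_X_le
  have h3 := hc.abs_moment_Y_le
  have h4 := hc.weighted_moment_le
  rw [← hμ [X, X] (by simp)] at h1 h3 h4
  rw [← hμ [X] (by simp)] at h2 h4
  rw [← hμ [Y] (by simp)] at h3 h4
  rw [← hμ [X, X, X, X] (by simp)] at h1 h2 h3 h4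
  have hd : 0 < β [X, X] - β [X, X, X, X] := sub_pos.2 (lt_of_le_of_ne h1 hne)
  have hP : 0 < β [X, X] - |β [X]| := by linarith
  have hQ : 0 < 1 - β [X, X] - |β [Y]| := by linarith
  refine ⟨hd, hP, hQ, ?_⟩
  generalize hPdef : β [X, X] - |β [X]| = P at *
  generalize hQdef : 1 - β [X, X] - |β [Y]| = Q at *
  generalize hddef : β [X, X] - β [X, X, X, X] = d at *
  -- `θ = Q / (P + Q)` minimizes `θ² P + (1 - θ)² Q`; the minimum is `PQ / (P + Q)`.
  have h5 : d ≤ (Q / (P + Q)) ^ 2 * P + (1 - Q / (P + Q)) ^ 2 * Q := by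
    have := h4 (Q / (P + Q))
    rw [← hPdef, ← hQdef] at this ⊢
    linarith
  have h6 : (Q / (P + Q)) ^ 2 * P + (1 - Q / (P + Q)) ^ 2 * Q = P * Q / (P + Q) := by
    field_simp
    ring
  rw [h6, le_div_iff₀ (by positivity)] at h5
  exact h5

/-! ### Measures supported on the four points and one irreducible pair -/

section Sites

/-- The size of an atom at a site: `none` stands for an irreducible pair of size two, `some j` for
one of the four points `(±1, 0)`, `(0, ±1)`. -/
def siteSize : Option (Fin 4) → ℕ
  | none => 2
  | some _ => 1

@[simp] theorem siteSize_none : siteSize none = 2 := rfl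

@[simp] theorem siteSize_some (j : Fin 4) : siteSize (some j) = 1 := rfl

/-- The first coordinates of the four points. -/
def pointX : Fin 4 → ℝ := ![1, -1, 0, 0]

/-- The second coordinates of the four points. -/
def pointY : Fin 4 → ℝ := ![0, 0, 1, -1]

/-- The first matrix of the atom at a site. -/
noncomputable def siteX (s : ℝ) : ∀ c, Matrix (Fin (siteSize c)) (Fin (siteSize c)) ℝ
  | none => normalX s
  | some j => of fun _ _ => pointX j

/-- The second matrix of the atom at a site. -/
noncomputable def siteY (s : ℝ) : ∀ c, Matrix (Fin (siteSize c)) (Fin (siteSize c)) ℝ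
  | none => normalY s
  | some j => of fun _ _ => pointY j

theorem siteSize_pos (c : Option (Fin 4)) : 0 < siteSize c := by
  cases c <;> simp

theorem siteX_isSymm (s : ℝ) (c : Option (Fin 4)) : (siteX s c).IsSymm := by
  cases c with
  | none =>
    refine IsSymm.ext fun i j => ?_
    change normalX s j i = normalX s i j
    change Fin 2 at i j
    fin_cases i <;> fin_cases j <;> simp [normalX]
  | some j => rfl

theorem siteY_isSymm (s : ℝ) (c : Option (Fin 4)) : (siteY s c).IsSymm := by
  cases c with
  | none =>
    refine IsSymm.ext fun i j => ?_
    change normalY s j i = normalY s i j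
    change Fin 2 at i j
    fin_cases i <;> fin_cases j <;> simp [normalY]
  | some j => rfl

theorem siteX_mul_siteY_add (s : ℝ) (c : Option (Fin 4)) :
    siteX s c * siteY s c + siteY s c * siteX s c = 0 := by
  cases c with
  | none =>
    change normalX s * normalY s + normalY s * normalX s = 0
    simp [normalX, normalY, ← Matrix.ext_iff, Fin.forall_fin_two, mul_comm]
  | some j =>
    change Matrix.of (fun (_ _ : Fin 1) => pointX j) * Matrix.of (fun (_ _ : Fin 1) => pointY j) +
      Matrix.of (fun (_ _ : Fin 1) => pointY j) * Matrix.of (fun (_ _ : Fin 1) => pointX j) = 0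
    ext i k
    fin_cases j <;> simp [mul_apply, pointX, pointY]

theorem siteX_sq_add_siteY_sq {s : ℝ} (h0 : 0 ≤ s) (h1 : s ≤ 1) (c : Option (Fin 4)) :
    siteX s c * siteX s c + siteY s c * siteY s c = 1 := by
  cases c with
  | none =>
    change normalX s * normalX s + normalY s * normalY s = 1
    simp [normalX, normalY, ← Matrix.ext_iff, Fin.forall_fin_two, h0, sub_nonneg.2 h1]
  | some j =>
    change Matrix.of (fun (_ _ : Fin 1) => pointX j) * Matrix.of (fun (_ _ : Fin 1) => pointX j) +
      Matrix.of (fun (_ _ : Fin 1) => pointY j) * Matrix.of (fun (_ _ : Fin 1) => pointY j) = 1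
    ext i k
    rw [Subsingleton.elim i 0, Subsingleton.elim k 0]
    fin_cases j <;> simp [mul_apply, pointX, pointY]

/-- The normalized trace of `w` at a site. -/
noncomputable def siteTrace (s : ℝ) (w : Word) (c : Option (Fin 4)) : ℝ :=
  (siteSize c : ℝ)⁻¹ * (evalWord (siteX s c) (siteY s c) w).trace

theorem siteTrace_some (s : ℝ) (w : Word) (j : Fin 4) :
    siteTrace s w (some j) =
      (evalWord (of fun (_ _ : Fin 1) => pointX j) (of fun _ _ => pointY j) w).trace := by
  change ((1 : ℕ) : ℝ)⁻¹ * _ = _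
  rw [Nat.cast_one, inv_one, one_mul]
  rfl

theorem siteTrace_none (s : ℝ) (w : Word) :
    siteTrace s w none = 2⁻¹ * (evalWord (normalX s) (normalY s) w).trace := by
  change ((2 : ℕ) : ℝ)⁻¹ * _ = _
  rw [Nat.cast_two]
  rfl

theorem sum_siteTrace_X (W : Option (Fin 4) → ℝ) (s : ℝ) :
    ∑ c, W c * siteTrace s [X] c = W (some 0) - W (some 1) := by
  simp [Fintype.sum_option, Fin.sum_univ_four, siteTrace_some, siteTrace_none, trace, pointX,
    normalX, sub_eq_add_neg]

theorem sum_siteTrace_Y (W : Option (Fin 4) → ℝ) (s : ℝ) :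
    ∑ c, W c * siteTrace s [Y] c = W (some 2) - W (some 3) := by
  simp [Fintype.sum_option, Fin.sum_univ_four, siteTrace_some, siteTrace_none, trace, pointY,
    normalY, sub_eq_add_neg]

theorem sum_siteTrace_XX (W : Option (Fin 4) → ℝ) {s : ℝ} (hs : 0 ≤ s) :
    ∑ c, W c * siteTrace s [X, X] c = W (some 0) + W (some 1) + W none * s := by
  simp [Fintype.sum_option, Fin.sum_univ_four, siteTrace_some, siteTrace_none, trace, pointX,
    normalX, mul_apply, hs]
  ring

theorem sum_siteTrace_XXXX (W : Option (Fin 4) → ℝ) {s : ℝ} (hs : 0 ≤ s) :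
    ∑ c, W c * siteTrace s [X, X, X, X] c = W (some 0) + W (some 1) + W none * s ^ 2 := by
  have h : √s * (√s * (√s * √s)) = s ^ 2 := by
    rw [Real.mul_self_sqrt hs, ← mul_assoc, Real.mul_self_sqrt hs, sq]
  simp only [Fintype.sum_option, Fin.sum_univ_four, siteTrace_some, siteTrace_none, trace, pointX,
    normalX, evalWord_cons_X, evalWord_nil, mul_one]
  simp [mul_apply]
  linear_combination W none * h

end Sites

namespace AtomicMeasure

/-- The measure with density `W c` at the site `c`, where sites of density zero are omitted. -/
noncomputable def ofSites (W : Option (Fin 4) → ℝ) (hsum : ∑ c, W c = 1) (hW : ∀ c, 0 ≤ W c)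
    (s : ℝ) : AtomicMeasure where
  N := (Finset.univ.filter fun c => 0 < W c).card
  size i := siteSize ((Finset.equivFin _).symm i).1
  size_pos _ := siteSize_pos _
  density i := W ((Finset.equivFin _).symm i).1
  density_pos i := (Finset.mem_filter.1 ((Finset.equivFin _).symm i).2).2
  sum_density := by
    rw [Equiv.sum_comp (Finset.equivFin (Finset.univ.filter fun c => 0 < W c)).symm
      (fun c => W c.1), Finset.sum_coe_sort _ W, ← hsum]
    exact Finset.sum_filter_of_ne fun c _ h => lt_of_le_of_ne (hW c) h.symm
  atomX i := siteX s _
  atomY i := siteY s _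
  symmX i := siteX_isSymm s _
  symmY i := siteY_isSymm s _

variable {W : Option (Fin 4) → ℝ} {hsum : ∑ c, W c = 1} {hW : ∀ c, 0 ≤ W c} {s : ℝ}

theorem sum_ofSites (g : Option (Fin 4) → ℝ) :
    ∑ i : Fin (ofSites W hsum hW s).N,
      W ((Finset.equivFin (Finset.univ.filter fun c => 0 < W c)).symm i).1 *
        g ((Finset.equivFin (Finset.univ.filter fun c => 0 < W c)).symm i).1 =
      ∑ c, W c * g c := by
  refine (Equiv.sum_comp (Finset.equivFin (Finset.univ.filter fun c => 0 < W c)).symm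
      (fun c => W c.1 * g c.1)).trans ?_
  rw [Finset.sum_coe_sort _ fun c => W c * g c]
  exact Finset.sum_filter_of_ne fun c _ h =>
    lt_of_le_of_ne (hW c) fun h' => h (by rw [← h', zero_mul])

theorem moment_ofSites (w : Word) :
    (ofSites W hsum hW s).moment w = ∑ c, W c * siteTrace s w c :=
  sum_ofSites (s := s) (hsum := hsum) (hW := hW) (siteTrace s w)

theorem isCircular_ofSites (h0 : 0 ≤ s) (h1 : s ≤ 1) : (ofSites W hsum hW s).IsCircular where
  anticomm _ := siteX_mul_siteY_add s _
  circle _ := siteX_sq_add_siteY_sq h0 h1 _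

theorem atomCount_ofSites (n : ℕ) :
    (ofSites W hsum hW s).atomCount n =
      (Finset.univ.filter fun c => 0 < W c ∧ siteSize c = n).card := by
  rw [atomCount, ← Finset.filter_filter]
  refine Finset.card_bij
    (fun i _ => ((Finset.equivFin (Finset.univ.filter fun c => 0 < W c)).symm i).1) ?_ ?_ ?_
  · intro i hi
    exact Finset.mem_filter.2 ⟨((Finset.equivFin (Finset.univ.filter fun c => 0 < W c)).symm i).2,
      (Finset.mem_filter.1 hi).2⟩
  · intro i _ j _ h
    exact (Finset.equivFin _).symm.injective (Subtype.ext h)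
  · intro c hc
    obtain ⟨hc, hn⟩ := Finset.mem_filter.1 hc
    refine ⟨Finset.equivFin _ ⟨c, hc⟩, ?_, ?_⟩
    · refine Finset.mem_filter.2 ⟨Finset.mem_univ _, ?_⟩
      change siteSize ((Finset.equivFin _).symm (Finset.equivFin _ ⟨c, hc⟩)).1 = n
      rw [Equiv.symm_apply_apply]
      exact hn
    · rw [Equiv.symm_apply_apply]

theorem atomCount_one_ofSites :
    (ofSites W hsum hW s).atomCount 1 =
      (Finset.univ.filter fun j : Fin 4 => 0 < W (some j)).card := by
  rw [atomCount_ofSites]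
  refine Eq.trans (congrArg Finset.card ?_) (Finset.card_map Function.Embedding.some)
  ext c
  cases c <;> simp

theorem atomCount_two_ofSites (h : 0 < W none) : (ofSites W hsum hW s).atomCount 2 = 1 := by
  rw [atomCount_ofSites, Finset.card_eq_one]
  refine ⟨none, ?_⟩
  ext c
  cases c <;> simp [h]

theorem atomCount_ofSites_eq_zero {n : ℕ} (h1 : n ≠ 1) (h2 : n ≠ 2) :
    (ofSites W hsum hW s).atomCount n = 0 := by
  rw [atomCount_ofSites, Finset.card_eq_zero, Finset.filter_eq_empty_iff]
  rintro (_ | j) - ⟨-, h⟩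
  · exact h2 h.symm
  · exact h1 h.symm

theorem maxSize_ofSites (h : 0 < W none) : (ofSites W hsum hW s).maxSize = 2 := by
  apply le_antisymm
  · refine Finset.sup_le fun i _ => ?_
    change siteSize _ ≤ 2
    cases ((Finset.equivFin (Finset.univ.filter fun c => 0 < W c)).symm i).1 <;> simp
  · have : 0 < (ofSites W hsum hW s).atomCount 2 := by rw [atomCount_two_ofSites h]; exact one_pos
    obtain ⟨i, hi⟩ := Finset.card_pos.1 this
    rw [← (Finset.mem_filter.1 hi).2]
    exact Finset.le_sup (f := (ofSites W hsum hW s).size) (Finset.mem_univ i)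

theorem type_ofSites (h : 0 < W none) : (ofSites W hsum hW s).type =
    [(Finset.univ.filter fun j : Fin 4 => 0 < W (some j)).card, 1] := by
  rw [type, maxSize_ofSites h]
  simp [List.range_succ, atomCount_one_ofSites, atomCount_two_ofSites h]

end AtomicMeasure

/-! ### Orthogonal equivalence and recognition of atoms -/

section Conjugation

theorem eq_of_orthogonal {m n : ℕ} {U : Matrix (Fin m) (Fin n) ℝ} (hU : U * Uᵀ = 1)
    (hU' : Uᵀ * U = 1) : m = n := by
  have h := Matrix.trace_mul_comm U Uᵀ
  rw [hU, hU', trace_one, trace_one, Fintype.card_fin, Fintype.card_fin] at h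
  exact_mod_cast h

theorem evalWord_conj {m n : ℕ} {U : Matrix (Fin m) (Fin n) ℝ} (hU : U * Uᵀ = 1)
    (hU' : Uᵀ * U = 1) (A B : Matrix (Fin n) (Fin n) ℝ) (w : Word) :
    evalWord (U * A * Uᵀ) (U * B * Uᵀ) w = U * evalWord A B w * Uᵀ := by
  induction w with
  | nil => simp [hU]
  | cons l w ih => cases l <;> simp [ih, conj_mul_conj hU']

theorem conj_conj_transpose {m n : ℕ} {U : Matrix (Fin m) (Fin n) ℝ} (hU' : Uᵀ * U = 1)
    (M : Matrix (Fin n) (Fin n) ℝ) : Uᵀ * (U * M * Uᵀ) * Uᵀᵀ = M := by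
  rw [transpose_transpose]
  calc Uᵀ * (U * M * Uᵀ) * U = (Uᵀ * U) * M * (Uᵀ * U) := by simp only [Matrix.mul_assoc]
    _ = M := by rw [hU', Matrix.one_mul, Matrix.mul_one]

namespace AtomicMeasure

theorem OrthEquiv.symm {μ ν : AtomicMeasure} (h : μ.OrthEquiv ν) : ν.OrthEquiv μ := by
  obtain ⟨σ, h⟩ := h
  refine ⟨σ.symm, fun i => ?_⟩
  obtain ⟨j, rfl⟩ := σ.surjective i
  obtain ⟨hd, U, hU, hU', hX, hY⟩ := h j
  -- The matrix sizes depend on the index, so `σ.symm (σ j)` is replaced by a variable `k` before it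
  -- is identified with `j`.
  have key : ∀ k, k = j → ν.density (σ j) = μ.density k ∧
      ∃ V : Matrix (Fin (μ.size k)) (Fin (ν.size (σ j))) ℝ, V * Vᵀ = 1 ∧ Vᵀ * V = 1 ∧
        μ.atomX k = V * ν.atomX (σ j) * Vᵀ ∧ μ.atomY k = V * ν.atomY (σ j) * Vᵀ := by
    rintro k rfl
    refine ⟨hd.symm, Uᵀ, by rwa [transpose_transpose], by rwa [transpose_transpose], ?_, ?_⟩
    · rw [hX, conj_conj_transpose hU']
    · rw [hY, conj_conj_transpose hU']
  exact key _ (σ.symm_apply_apply j)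

theorem OrthEquiv.trans {μ ν κ : AtomicMeasure} (h : μ.OrthEquiv ν) (h' : ν.OrthEquiv κ) :
    μ.OrthEquiv κ := by
  obtain ⟨σ, h⟩ := h
  obtain ⟨τ, h'⟩ := h'
  refine ⟨σ.trans τ, fun i => ?_⟩
  obtain ⟨hd, U, hU, hU', hX, hY⟩ := h i
  obtain ⟨hd', V, hV, hV', hX', hY'⟩ := h' (σ i)
  change μ.density i = κ.density (τ (σ i)) ∧
    ∃ U : Matrix (Fin (κ.size (τ (σ i)))) (Fin (μ.size i)) ℝ, U * Uᵀ = 1 ∧ Uᵀ * U = 1 ∧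
      κ.atomX (τ (σ i)) = U * μ.atomX i * Uᵀ ∧ κ.atomY (τ (σ i)) = U * μ.atomY i * Uᵀ
  refine ⟨hd.trans hd', V * U, ?_, ?_, ?_, ?_⟩
  · rw [transpose_mul]
    calc V * U * (Uᵀ * Vᵀ) = V * (U * Uᵀ) * Vᵀ := by simp only [Matrix.mul_assoc]
      _ = 1 := by rw [hU, Matrix.mul_one, hV]
  · rw [transpose_mul]
    calc Uᵀ * Vᵀ * (V * U) = Uᵀ * (Vᵀ * V) * U := by simp only [Matrix.mul_assoc]
      _ = 1 := by rw [hV', Matrix.mul_one, hU']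
  · rw [transpose_mul]
    rw [hX', hX]
    simp only [Matrix.mul_assoc]
  · rw [transpose_mul]
    rw [hY', hY]
    simp only [Matrix.mul_assoc]

/-- The contribution of the atoms of size two to the moment of `X²`, up to a factor. -/
noncomputable def sizeTwoMoment (μ : AtomicMeasure) : ℝ :=
  ∑ i, μ.density i * if μ.size i = 2 then (μ.atomX i * μ.atomX i).trace else 0

theorem OrthEquiv.sizeTwoMoment_eq {μ ν : AtomicMeasure} (h : μ.OrthEquiv ν) :
    μ.sizeTwoMoment = ν.sizeTwoMoment := by
  obtain ⟨σ, h⟩ := h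
  rw [sizeTwoMoment, sizeTwoMoment, ← Equiv.sum_comp σ]
  refine Finset.sum_congr rfl fun i _ => ?_
  obtain ⟨hd, U, hU, hU', hX, -⟩ := h i
  rw [hd, hX, conj_mul_conj hU', trace_conj hU', eq_of_orthogonal hU hU']

end AtomicMeasure

/-- The pair `(A, B)` is orthogonally conjugate to the atom at the site `c`. -/
def IsSite (s : ℝ) (c : Option (Fin 4)) {t : ℕ} (A B : Matrix (Fin t) (Fin t) ℝ) : Prop :=
  ∃ U : Matrix (Fin t) (Fin (siteSize c)) ℝ, U * Uᵀ = 1 ∧ Uᵀ * U = 1 ∧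
    A = U * siteX s c * Uᵀ ∧ B = U * siteY s c * Uᵀ

theorem isSite_self (s : ℝ) (c : Option (Fin 4)) : IsSite s c (siteX s c) (siteY s c) :=
  ⟨1, by simp, by simp, by simp, by simp⟩

theorem IsSite.size_eq {s : ℝ} {c : Option (Fin 4)} {t : ℕ} {A B : Matrix (Fin t) (Fin t) ℝ}
    (h : IsSite s c A B) : t = siteSize c := by
  obtain ⟨U, hU, hU', -⟩ := h
  exact eq_of_orthogonal hU hU'

theorem IsSite.trace_eq {s : ℝ} {c : Option (Fin 4)} {t : ℕ} {A B : Matrix (Fin t) (Fin t) ℝ}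
    (h : IsSite s c A B) (w : Word) :
    (t : ℝ)⁻¹ * (evalWord A B w).trace = siteTrace s w c := by
  have ht := h.size_eq
  obtain ⟨U, hU, hU', rfl, rfl⟩ := h
  rw [evalWord_conj hU hU', trace_conj hU', siteTrace, ht]

/-- For scalars the relations become `xy = 0` and `x² + y² = 1`. -/
theorem exists_isSite_of_size_one (s : ℝ) {t : ℕ} (ht : t = 1) {A B : Matrix (Fin t) (Fin t) ℝ}
    (hanti : A * B + B * A = 0) (hcirc : A * A + B * B = 1) :
    ∃ j, IsSite s (some j) A B := by
  subst ht
  have h1 := congrFun (congrFun hanti 0) 0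
  have h2 := congrFun (congrFun hcirc 0) 0
  simp only [Matrix.add_apply, Matrix.mul_apply, Fin.sum_univ_one, Matrix.zero_apply,
    one_apply_eq] at h1 h2
  have key (j : Fin 4) (hX : A 0 0 = pointX j) (hY : B 0 0 = pointY j) : IsSite s (some j) A B := by
    have hA : A = siteX s (some j) := by
      ext i k
      rw [Subsingleton.elim i 0, Subsingleton.elim k 0, hX]
      rfl
    have hB : B = siteY s (some j) := by
      ext i k
      rw [Subsingleton.elim i 0, Subsingleton.elim k 0, hY]
      rfl
    rw [hA, hB]
    exact isSite_self s (some j)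
  have h3 : A 0 0 * B 0 0 = 0 := by linarith
  rcases mul_eq_zero.1 h3 with h | h
  · have : B 0 0 * B 0 0 = 1 := by simpa [h] using h2
    rcases mul_self_eq_one_iff.1 this with h' | h'
    · exact ⟨2, key 2 (by simp [h, pointX]) (by simp [h', pointY])⟩
    · exact ⟨3, key 3 (by simp [h, pointX]) (by simp [h', pointY])⟩
  · have : A 0 0 * A 0 0 = 1 := by simpa [h] using h2
    rcases mul_self_eq_one_iff.1 this with h' | h'
    · exact ⟨0, key 0 (by simp [h', pointX]) (by simp [h, pointY])⟩
    · exact ⟨1, key 1 (by simp [h', pointX]) (by simp [h, pointY])⟩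

theorem mul_eq_zero_of_size_one {t : ℕ} (ht : t = 1) {A B : Matrix (Fin t) (Fin t) ℝ}
    (hanti : A * B + B * A = 0) : A * B = 0 := by
  subst ht
  ext i k
  have h1 := congrFun (congrFun hanti 0) 0
  rw [Subsingleton.elim i 0, Subsingleton.elim k 0]
  simp only [Matrix.add_apply, Matrix.mul_apply, Fin.sum_univ_one, Matrix.zero_apply] at h1 ⊢
  linarith

theorem exists_isSite_of_size_two {t : ℕ} (ht : t = 2) {A B : Matrix (Fin t) (Fin t) ℝ}
    (hA : A.IsSymm) (hB : B.IsSymm) (hanti : A * B + B * A = 0) (hcirc : A * A + B * B = 1)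
    (hne : A * B ≠ 0) : ∃ s, 0 < s ∧ s < 1 ∧ IsSite s none A B := by
  subst ht
  exact exists_orthogonal_normal_form hA hB hanti hcirc hne

end Conjugation

/-! ### Labelling the atoms of a measure by sites -/

namespace AtomicMeasure

section Labelling

variable {ν : AtomicMeasure} {s : ℝ} {cls : Fin ν.N → Option (Fin 4)}

/-- The total density of the atoms labelled by the site `c`. -/
noncomputable def labelWeight (ν : AtomicMeasure) (cls : Fin ν.N → Option (Fin 4))
    (c : Option (Fin 4)) : ℝ :=
  ∑ i with cls i = c, ν.density i

theorem sum_labelWeight_mul (ν : AtomicMeasure) (cls : Fin ν.N → Option (Fin 4))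
    (g : Option (Fin 4) → ℝ) :
    ∑ c, ν.labelWeight cls c * g c = ∑ i, ν.density i * g (cls i) := by
  rw [← Finset.sum_fiberwise Finset.univ cls]
  refine Finset.sum_congr rfl fun c _ => ?_
  rw [labelWeight, Finset.sum_mul]
  refine Finset.sum_congr rfl fun i hi => ?_
  rw [(Finset.mem_filter.1 hi).2]

theorem sum_labelWeight (ν : AtomicMeasure) (cls : Fin ν.N → Option (Fin 4)) :
    ∑ c, ν.labelWeight cls c = 1 := by
  simpa [ν.sum_density] using ν.sum_labelWeight_mul cls fun _ => 1

theorem labelWeight_nonneg (ν : AtomicMeasure) (cls : Fin ν.N → Option (Fin 4))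
    (c : Option (Fin 4)) : 0 ≤ ν.labelWeight cls c :=
  Finset.sum_nonneg fun i _ => (ν.density_pos i).le

theorem labelWeight_pos_iff (ν : AtomicMeasure) (cls : Fin ν.N → Option (Fin 4))
    (c : Option (Fin 4)) : 0 < ν.labelWeight cls c ↔ ∃ i, cls i = c := by
  constructor
  · intro h
    by_contra! h'
    rw [labelWeight, Finset.filter_eq_empty_iff.2 fun i _ => h' i, Finset.sum_empty] at h
    exact lt_irrefl _ h
  · rintro ⟨i, hi⟩
    exact Finset.sum_pos (fun i _ => ν.density_pos i) ⟨i, by simp [hi]⟩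

theorem labelWeight_of_injective (hinj : Function.Injective cls) (i : Fin ν.N) :
    ν.labelWeight cls (cls i) = ν.density i := by
  rw [labelWeight]
  have : (Finset.univ.filter fun k => cls k = cls i) = {i} := by
    ext k
    simp [hinj.eq_iff]
  rw [this, Finset.sum_singleton]

theorem moment_eq_sum_siteTrace (hcls : ∀ i, IsSite s (cls i) (ν.atomX i) (ν.atomY i))
    (w : Word) : ν.moment w = ∑ c, ν.labelWeight cls c * siteTrace s w c := by
  rw [sum_labelWeight_mul]
  exact Finset.sum_congr rfl fun i _ => by rw [(hcls i).trace_eq]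

/-- `ofSites` merges atoms with the same label. When labels are distinct nothing is merged, and
labelling is a bijection from the atoms onto the sites of positive weight. -/
theorem orthEquiv_ofSites (hcls : ∀ i, IsSite s (cls i) (ν.atomX i) (ν.atomY i))
    (hinj : Function.Injective cls) {W : Option (Fin 4) → ℝ} (hsum : ∑ c, W c = 1)
    (hW : ∀ c, 0 ≤ W c) (h : ν.labelWeight cls = W) :
    ν.OrthEquiv (ofSites W hsum hW s) := by
  subst h
  have hmem (i) : cls i ∈ Finset.univ.filter fun c => 0 < ν.labelWeight cls c := by
    rw [Finset.mem_filter]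
    exact ⟨Finset.mem_univ _, (ν.labelWeight_pos_iff cls _).2 ⟨i, rfl⟩⟩
  let τ : Fin ν.N ≃ (Finset.univ.filter fun c => 0 < ν.labelWeight cls c) :=
    Equiv.ofBijective (fun i => ⟨cls i, hmem i⟩)
      ⟨fun i j hij => hinj (congrArg Subtype.val hij), fun ⟨c, hc⟩ => by
        obtain ⟨i, hi⟩ := (ν.labelWeight_pos_iff cls c).1 (Finset.mem_filter.1 hc).2
        exact ⟨i, Subtype.ext hi⟩⟩
  refine ⟨τ.trans (Finset.equivFin _), fun i => ?_⟩
  have key : ∀ c, c = cls i → ν.density i = ν.labelWeight cls c ∧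
      ∃ U : Matrix (Fin (siteSize c)) (Fin (ν.size i)) ℝ, U * Uᵀ = 1 ∧ Uᵀ * U = 1 ∧
        siteX s c = U * ν.atomX i * Uᵀ ∧ siteY s c = U * ν.atomY i * Uᵀ := by
    rintro c rfl
    obtain ⟨U, hU, hU', hX, hY⟩ := hcls i
    refine ⟨(labelWeight_of_injective hinj i).symm, Uᵀ, by rwa [transpose_transpose],
      by rwa [transpose_transpose], ?_, ?_⟩
    · rw [hX, conj_conj_transpose hU']
    · rw [hY, conj_conj_transpose hU']
  refine key ((Finset.equivFin _).symm (Finset.equivFin _ (τ i))).1 ?_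
  rw [Equiv.symm_apply_apply]
  rfl

/-- The charged points are the image of the size-one atoms under the labelling. Equal cardinality
makes the labelling injective on those atoms, and at most one atom carries the label `none`. -/
theorem card_labelWeight_pos_le (hcls : ∀ i, IsSite s (cls i) (ν.atomX i) (ν.atomY i)) :
    (Finset.univ.filter fun j : Fin 4 => 0 < ν.labelWeight cls (some j)).card ≤ ν.atomCount 1 ∧
      ((Finset.univ.filter fun j : Fin 4 => 0 < ν.labelWeight cls (some j)).card =
          ν.atomCount 1 → ν.atomCount 2 ≤ 1 → Function.Injective cls) := by
  have himg : (Finset.univ.filter fun j : Fin 4 => 0 < ν.labelWeight cls (some j)).map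
      Function.Embedding.some = (Finset.univ.filter fun i => ν.size i = 1).image cls := by
    ext c
    simp only [Finset.mem_map, Finset.mem_filter, Finset.mem_univ, true_and, Finset.mem_image,
      labelWeight_pos_iff, Function.Embedding.some_apply]
    constructor
    · rintro ⟨j, ⟨i, hi⟩, rfl⟩
      refine ⟨i, ?_, hi⟩
      rw [(hcls i).size_eq, hi]
      rfl
    · rintro ⟨i, hi, rfl⟩
      have := (hcls i).size_eq
      cases hc : cls i with
      | none => rw [hi, hc] at this; exact absurd this (by simp)
      | some j => exact ⟨j, ⟨i, hc⟩, rfl⟩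
  rw [← Finset.card_map Function.Embedding.some, himg]
  refine ⟨Finset.card_image_le, fun h h2 i k hik => ?_⟩
  have hinj := Finset.card_image_iff.1 h
  have hsi := (hcls i).size_eq
  have hsk := (hcls k).size_eq
  cases hc : cls i with
  | none =>
    rw [hc] at hsi
    rw [← hik, hc] at hsk
    exact Finset.card_le_one.1 h2 i (by simpa using hsi) k (by simpa using hsk)
  | some j =>
    rw [hc] at hsi
    rw [← hik, hc] at hsk
    exact hinj (by simpa using hsi) (by simpa using hsk) hik

end Labelling

/-- Source of the irreducible atom: if all products `AB` vanished, so would the moment of `X²Y²`. -/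
theorem Represents.exists_mul_ne_zero {ν : AtomicMeasure} {β : Word → ℝ} (hν : ν.Represents β)
    (hne : β [X, X, Y, Y] ≠ 0) : ∃ i, ν.atomX i * ν.atomY i ≠ 0 := by
  by_contra! h
  apply hne
  rw [hν _ (by simp)]
  refine Finset.sum_eq_zero fun i _ => ?_
  have : ν.atomX i * (ν.atomY i * ν.atomY i) = 0 := by rw [← Matrix.mul_assoc, h i, Matrix.zero_mul]
  simp [this]

theorem size_le_maxSize (ν : AtomicMeasure) (i : Fin ν.N) : ν.size i ≤ ν.maxSize :=
  Finset.le_sup (f := ν.size) (Finset.mem_univ i)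

theorem IsCircular.two_le_size {ν : AtomicMeasure} (hν : ν.IsCircular) {i : Fin ν.N}
    (h : ν.atomX i * ν.atomY i ≠ 0) : 2 ≤ ν.size i := by
  by_contra! h'
  have := ν.size_pos i
  exact h (mul_eq_zero_of_size_one (by omega) (hν.anticomm i))

theorem Represents.exists_labelling {ν : AtomicMeasure} {β : Word → ℝ} (hν : ν.Represents β)
    (hβ : CircleRelations β) (hne : β [X, X, Y, Y] ≠ 0) (hmax : ν.maxSize ≤ 2)
    (hcount : ν.atomCount 2 ≤ 1) :
    ∃ s, 0 < s ∧ s < 1 ∧ ∃ cls : Fin ν.N → Option (Fin 4), (∃ i, cls i = none) ∧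
      ∀ i, IsSite s (cls i) (ν.atomX i) (ν.atomY i) := by
  have hc := hν.isCircular hβ
  obtain ⟨i₀, hi₀⟩ := hν.exists_mul_ne_zero hne
  have hsize : ν.size i₀ = 2 :=
    le_antisymm ((ν.size_le_maxSize i₀).trans hmax) (hc.two_le_size hi₀)
  obtain ⟨s, hs0, hs1, hs⟩ := exists_isSite_of_size_two hsize (ν.symmX i₀) (ν.symmY i₀)
    (hc.anticomm i₀) (hc.circle i₀) hi₀
  have hex (i) : ∃ c, IsSite s c (ν.atomX i) (ν.atomY i) := by
    by_cases hi : ν.size i = 2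
    · have : i = i₀ := Finset.card_le_one.1 hcount i (by simpa using hi) i₀ (by simpa using hsize)
      exact ⟨none, this ▸ hs⟩
    · have h1 := ν.size_pos i
      have h2 := ν.size_le_maxSize i
      obtain ⟨j, hj⟩ := exists_isSite_of_size_one s (by omega) (hc.anticomm i) (hc.circle i)
      exact ⟨some j, hj⟩
  choose cls hcls using hex
  refine ⟨s, hs0, hs1, cls, ⟨i₀, ?_⟩, hcls⟩
  have := (hcls i₀).size_eq
  rw [hsize] at this
  cases h : cls i₀ with
  | none => rfl
  | some j => rw [h] at this; exact absurd this (by simp)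

end AtomicMeasure

/-! ### Measures with one irreducible atom, parametrized by `(P, Q)` -/

section Parameters

/-- The densities at the sites of the measure with parameters `(P, Q)`. -/
noncomputable def siteWeight (a b p P Q : ℝ) : Option (Fin 4) → ℝ
  | none => P + Q
  | some j => ![(p - P + a) / 2, (p - P - a) / 2, (1 - p - Q + b) / 2, (1 - p - Q - b) / 2] j

/-- The number of atoms of size one of the measure with parameters `(P, Q)`. -/
noncomputable def pointCount (a b p P Q : ℝ) : ℕ :=
  (Finset.univ.filter fun j : Fin 4 => 0 < siteWeight a b p P Q (some j)).card

/-- The number of positive densities among `(u + a) / 2` and `(u - a) / 2`. -/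
noncomputable def axisCount (u a : ℝ) : ℕ :=
  (if 0 < (u + a) / 2 then 1 else 0) + (if 0 < (u - a) / 2 then 1 else 0)

theorem pointCount_eq (a b p P Q : ℝ) :
    pointCount a b p P Q = axisCount (p - P) a + axisCount (1 - p - Q) b := by
  rw [pointCount, Finset.card_filter, Fin.sum_univ_four, axisCount, axisCount, ← add_assoc]
  rfl

theorem axisCount_of_abs_lt {u a : ℝ} (h : |a| < u) : axisCount u a = 2 := by
  obtain ⟨h1, h2⟩ := abs_lt.1 h
  rw [axisCount, if_pos (by linarith), if_pos (by linarith)]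

theorem axisCount_abs {a : ℝ} (h : a ≠ 0) : axisCount |a| a = 1 := by
  rcases lt_or_gt_of_ne h with h | h
  · rw [axisCount, abs_of_neg h, if_neg (by linarith), if_pos (by linarith)]
  · rw [axisCount, abs_of_pos h, if_pos (by linarith), if_neg (by linarith)]

theorem axisCount_zero : axisCount |0| 0 = 0 := by simp [axisCount]

variable {a b p d P Q : ℝ}

theorem sum_siteWeight (a b p P Q : ℝ) : ∑ c, siteWeight a b p P Q c = 1 := by
  simp only [Fintype.sum_option, Fin.sum_univ_four, siteWeight]
  simp
  ring

/-- The points `(±1, 0)` share the total `p - P` with difference `a`, and `(0, ±1)` share `1 - p -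
Q` with difference `b`; the two upper bounds in `Feasible` are exactly nonnegativity of these
densities. -/
theorem Feasible.siteWeight_nonneg (h : Feasible a b p d P Q) (c : Option (Fin 4)) :
    0 ≤ siteWeight a b p P Q c := by
  have h1 := h.P_le
  have h2 := h.Q_le
  have h3 := le_abs_self a
  have h4 := neg_abs_le a
  have h5 := le_abs_self b
  have h6 := neg_abs_le b
  cases c with
  | none => exact (add_pos h.P_pos h.Q_pos).le
  | some j => fin_cases j <;> simp [siteWeight] <;> linarith

/-- The measure with parameters `(P, Q)`. -/
noncomputable def Feasible.measure (h : Feasible a b p d P Q) : AtomicMeasure :=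
  AtomicMeasure.ofSites (siteWeight a b p P Q) (sum_siteWeight a b p P Q) h.siteWeight_nonneg
    (P / (P + Q))

theorem Feasible.siteWeight_none_pos (h : Feasible a b p d P Q) :
    0 < siteWeight a b p P Q none := add_pos h.P_pos h.Q_pos

theorem Feasible.maxSize_measure (h : Feasible a b p d P Q) : h.measure.maxSize = 2 :=
  AtomicMeasure.maxSize_ofSites h.siteWeight_none_pos

theorem Feasible.type_measure (h : Feasible a b p d P Q) :
    h.measure.type = [pointCount a b p P Q, 1] :=
  AtomicMeasure.type_ofSites h.siteWeight_none_pos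

theorem Feasible.atomCount_one_measure (h : Feasible a b p d P Q) :
    h.measure.atomCount 1 = pointCount a b p P Q :=
  AtomicMeasure.atomCount_one_ofSites

theorem Feasible.atomCount_two_measure (h : Feasible a b p d P Q) :
    h.measure.atomCount 2 = 1 :=
  AtomicMeasure.atomCount_two_ofSites h.siteWeight_none_pos

theorem Feasible.atomCount_measure_eq_zero (h : Feasible a b p d P Q) {n : ℕ} (h1 : n ≠ 1)
    (h2 : n ≠ 2) : h.measure.atomCount n = 0 :=
  AtomicMeasure.atomCount_ofSites_eq_zero h1 h2

theorem Feasible.sizeTwoMoment_measure (h : Feasible a b p d P Q) :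
    h.measure.sizeTwoMoment = 2 * P := by
  have hP := h.P_pos
  have hQ := h.Q_pos
  have hs : 0 ≤ P / (P + Q) := by positivity
  refine (AtomicMeasure.sum_ofSites (hsum := sum_siteWeight a b p P Q) (hW := h.siteWeight_nonneg)
    (s := P / (P + Q)) (fun c => if siteSize c = 2 then
      (siteX (P / (P + Q)) c * siteX (P / (P + Q)) c).trace else 0)).trans ?_
  rw [Fintype.sum_option, Finset.sum_eq_zero fun j _ => by simp, add_zero,
    if_pos siteSize_none]
  change (P + Q) * (normalX (P / (P + Q)) * normalX (P / (P + Q))).trace = 2 * P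
  have : (normalX (P / (P + Q)) * normalX (P / (P + Q))).trace = 2 * (P / (P + Q)) := by
    rw [normalX, trace_fin_two]
    simp only [mul_apply, Fin.sum_univ_two]
    simp [Real.mul_self_sqrt hs]
    ring
  rw [this]
  field_simp

/-- `2 * P` is an invariant of orthogonal equivalence; this separates the two minimal measures when
there are two. -/
theorem Feasible.eq_of_orthEquiv {P' Q' : ℝ} (h : Feasible a b p d P Q)
    (h' : Feasible a b p d P' Q') (he : h.measure.OrthEquiv h'.measure) : P = P' := by
  have := he.sizeTwoMoment_eq
  rw [h.sizeTwoMoment_measure, h'.sizeTwoMoment_measure] at this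
  linarith

end Parameters

/-- The set of parameters attached to a sequence. -/
abbrev FeasibleFor (β : Word → ℝ) (P Q : ℝ) : Prop :=
  Feasible (β [X]) (β [Y]) (β [X, X]) (β [X, X] - β [X, X, X, X]) P Q

/-- The number of atoms of size one attached to a sequence and parameters `(P, Q)`. -/
noncomputable abbrev pointCountFor (β : Word → ℝ) (P Q : ℝ) : ℕ :=
  pointCount (β [X]) (β [Y]) (β [X, X]) P Q

/-! ### Minimal measures correspond to feasible parameters with fewest points -/

section Minimal

variable {β : Word → ℝ} {P Q : ℝ}

theorem Feasible.represents (h : FeasibleFor β P Q) (hβ : CircleRelations β) :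
    h.measure.Represents β := by
  have hP := h.P_pos
  have hQ := h.Q_pos
  have hs0 : 0 ≤ P / (P + Q) := by positivity
  have hs1 : P / (P + Q) ≤ 1 := by rw [div_le_one (by positivity)]; linarith
  refine (AtomicMeasure.isCircular_ofSites hs0 hs1).represents hβ ?_ ?_ ?_ ?_
  · rw [AtomicMeasure.moment_ofSites, sum_siteTrace_X]
    simp [siteWeight]
    ring
  · rw [AtomicMeasure.moment_ofSites, sum_siteTrace_Y]
    simp [siteWeight]
    ring
  · rw [AtomicMeasure.moment_ofSites, sum_siteTrace_XX _ hs0]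
    simp [siteWeight]
    field_simp
    ring
  · rw [AtomicMeasure.moment_ofSites, sum_siteTrace_XXXX _ hs0]
    have hc := h.curve
    simp [siteWeight]
    field_simp
    linarith

/-- Merging atoms with equal labels yields the measure with `P = W s`, `Q = W (1 - s)`, where `W` is
the density of the irreducible atom. Merging cannot increase the number of points, and if it does
not decrease it, nothing was merged. -/
theorem AtomicMeasure.Represents.exists_feasible {ν : AtomicMeasure} (hν : ν.Represents β)
    (hβ : CircleRelations β) (hne : β [X, X, Y, Y] ≠ 0) (hmax : ν.maxSize ≤ 2)
    (hcount : ν.atomCount 2 ≤ 1) :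
    ∃ P Q, ∃ h : FeasibleFor β P Q, pointCountFor β P Q ≤ ν.atomCount 1 ∧
      (pointCountFor β P Q = ν.atomCount 1 → ν.OrthEquiv h.measure) := by
  obtain ⟨s, hs0, hs1, cls, hnone, hcls⟩ := hν.exists_labelling hβ hne hmax hcount
  obtain ⟨W, hWdef⟩ : ∃ W, ν.labelWeight cls = W := ⟨_, rfl⟩
  have hW (c) : 0 ≤ W c := hWdef ▸ ν.labelWeight_nonneg cls c
  have hpos : 0 < W none := hWdef ▸ (ν.labelWeight_pos_iff cls none).2 hnone
  have hm {w : Word} (hw : w.length ≤ 4) : β w = ∑ c, W c * siteTrace s w c := by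
    rw [hν w hw, moment_eq_sum_siteTrace hcls, hWdef]
  have ea := hm (w := [X]) (by simp)
  have eb := hm (w := [Y]) (by simp)
  have ep := hm (w := [X, X]) (by simp)
  have eq := hm (w := [X, X, X, X]) (by simp)
  rw [sum_siteTrace_X] at ea
  rw [sum_siteTrace_Y] at eb
  rw [sum_siteTrace_XX _ hs0.le] at ep
  rw [sum_siteTrace_XXXX _ hs0.le] at eq
  have esum : ∑ c, W c = 1 := hWdef ▸ ν.sum_labelWeight cls
  rw [Fintype.sum_option, Fin.sum_univ_four] at esum
  have h0 := hW (some 0)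
  have h1 := hW (some 1)
  have h2 := hW (some 2)
  have h3 := hW (some 3)
  have hf : FeasibleFor β (W none * s) (W none * (1 - s)) :=
    { P_pos := mul_pos hpos hs0
      Q_pos := mul_pos hpos (sub_pos.2 hs1)
      P_le := by
        have : |β [X]| ≤ W (some 0) + W (some 1) := by rw [ea, abs_le]; constructor <;> linarith
        linarith
      Q_le := by
        have : |β [Y]| ≤ W (some 2) + W (some 3) := by rw [eb, abs_le]; constructor <;> linarith
        linarith
      curve := by rw [ep, eq]; ring }
  have hWeq : W = siteWeight (β [X]) (β [Y]) (β [X, X]) (W none * s) (W none * (1 - s)) := by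
    funext c
    cases c with
    | none => simp only [siteWeight]; ring
    | some j => fin_cases j <;> simp [siteWeight] <;> linarith
  have hseq : W none * s / (W none * s + W none * (1 - s)) = s := by
    rw [show W none * s + W none * (1 - s) = W none by ring, mul_div_cancel_left₀ _ hpos.ne']
  have hcard := card_labelWeight_pos_le hcls
  rw [hWdef.trans hWeq] at hcard
  refine ⟨_, _, hf, hcard.1, fun h => ?_⟩
  rw [Feasible.measure, hseq]
  exact orthEquiv_ofSites hcls (hcard.2 h hcount) _ _ (hWdef.trans hWeq)

theorem AtomicMeasure.Represents.two_le_maxSize {ν : AtomicMeasure} (hν : ν.Represents β)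
    (hβ : CircleRelations β) (hne : β [X, X, Y, Y] ≠ 0) : 2 ≤ ν.maxSize := by
  obtain ⟨i, hi⟩ := hν.exists_mul_ne_zero hne
  exact ((hν.isCircular hβ).two_le_size hi).trans (ν.size_le_maxSize i)

theorem AtomicMeasure.atomCount_eq_zero_of_maxSize_lt (ν : AtomicMeasure) {n : ℕ}
    (h : ν.maxSize < n) : ν.atomCount n = 0 := by
  rw [atomCount, Finset.card_eq_zero, Finset.filter_eq_empty_iff]
  intro i _ hi
  have := ν.size_le_maxSize i
  omega

theorem Feasible.isMinimal (h : FeasibleFor β P Q) (hβ : CircleRelations β)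
    (hne : β [X, X, Y, Y] ≠ 0)
    (hmin : ∀ P' Q', FeasibleFor β P' Q' → pointCountFor β P Q ≤ pointCountFor β P' Q') :
    h.measure.IsMinimal β := by
  refine ⟨h.represents hβ, fun ν hν hsmall => ?_⟩
  have hmax := hν.two_le_maxSize hβ hne
  obtain ⟨i, hi⟩ := hν.exists_mul_ne_zero hne
  have hi2 := (hν.isCircular hβ).two_le_size hi
  have him := ν.size_le_maxSize i
  rcases hsmall with hlt | ⟨heq, n, hn, hgt⟩
  · rw [h.maxSize_measure] at hlt
    omega
  · rw [h.maxSize_measure] at heq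
    rcases eq_or_ne n 1 with rfl | hn1
    · have hc2 := hgt 2 (by norm_num)
      rw [h.atomCount_two_measure] at hc2
      obtain ⟨P', Q', h', hle, -⟩ := hν.exists_feasible hβ hne heq.le hc2.le
      rw [h.atomCount_one_measure] at hn
      exact absurd (hmin P' Q' h') (by simp only [pointCountFor] at *; omega)
    · rcases eq_or_ne n 2 with rfl | hn2
      · rw [h.atomCount_two_measure, Nat.lt_one_iff, AtomicMeasure.atomCount,
          Finset.card_eq_zero, Finset.filter_eq_empty_iff] at hn
        exact hn (Finset.mem_univ i) (by omega)
      · rw [h.atomCount_measure_eq_zero hn1 hn2] at hn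
        omega

/-- Competing with the measure of a single feasible pair forces maximal size two and exactly one
atom of size two; competing with the merged measure then shows that no two atoms share a label. -/
theorem AtomicMeasure.IsMinimal.exists_feasible {ν : AtomicMeasure} (hν : ν.IsMinimal β)
    (hβ : CircleRelations β) (hne : β [X, X, Y, Y] ≠ 0) (h₀ : FeasibleFor β P Q) :
    ∃ P' Q', ∃ h : FeasibleFor β P' Q', pointCountFor β P' Q' ≤ pointCountFor β P Q ∧
      ν.OrthEquiv h.measure := by
  obtain ⟨hrep, hmin⟩ := hν
  have hmax2 := hrep.two_le_maxSize hβ hne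
  have hnot {P' Q' : ℝ} (h' : FeasibleFor β P' Q') := hmin _ (h'.represents hβ)
  have hmax : ν.maxSize = 2 := by
    by_contra hne'
    exact hnot h₀ (Or.inl (by rw [h₀.maxSize_measure]; omega))
  have hzero {P' Q' : ℝ} (h' : FeasibleFor β P' Q') {n : ℕ} (hn : 2 < n) :
      h'.measure.atomCount n = ν.atomCount n := by
    rw [h'.atomCount_measure_eq_zero (by omega) (by omega),
      ν.atomCount_eq_zero_of_maxSize_lt (by omega)]
  have hc2 : ν.atomCount 2 ≤ 1 := by
    by_contra! hlt
    exact hnot h₀ (Or.inr ⟨by rw [h₀.maxSize_measure, hmax], 2,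
      by rw [h₀.atomCount_two_measure]; exact hlt, fun n hn => hzero h₀ hn⟩)
  have hc2' : ν.atomCount 2 = 1 := by
    refine le_antisymm hc2 ?_
    obtain ⟨i, hi⟩ := hrep.exists_mul_ne_zero hne
    have h1 := (hrep.isCircular hβ).two_le_size hi
    have h2 := ν.size_le_maxSize i
    exact Finset.card_pos.2 ⟨i, by simp; omega⟩
  have hc1 {P' Q' : ℝ} (h' : FeasibleFor β P' Q') : ν.atomCount 1 ≤ pointCountFor β P' Q' := by
    by_contra! hlt
    refine hnot h' (Or.inr ⟨by rw [h'.maxSize_measure, hmax], 1,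
      by rw [h'.atomCount_one_measure]; exact hlt, fun n hn => ?_⟩)
    rcases eq_or_ne n 2 with rfl | hn2
    · rw [h'.atomCount_two_measure, hc2']
    · exact hzero h' (by omega)
  obtain ⟨P', Q', h', hle, heq⟩ := hrep.exists_feasible hβ hne hmax.le hc2
  exact ⟨P', Q', h', hle.trans (hc1 h₀), heq (le_antisymm hle (hc1 h'))⟩

/-- Types are totally ordered: at the largest size where the counts differ, one of the two measures
is smaller. This makes the cases of the classification mutually exclusive. -/
theorem AtomicMeasure.IsMinimal.type_eq {μ ν : AtomicMeasure} (hμ : μ.IsMinimal β)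
    (hν : ν.IsMinimal β) : μ.type = ν.type := by
  have h1 := hμ.2 ν hν.1
  have h2 := hν.2 μ hμ.1
  simp only [SmallerType, not_or, not_lt] at h1 h2
  have hmax : μ.maxSize = ν.maxSize := le_antisymm h1.1 h2.1
  suffices h : ∀ n, μ.atomCount n = ν.atomCount n by
    simp only [type, hmax, h]
  by_contra! h
  obtain ⟨n, hn⟩ := h
  classical
  have hn' : n ≤ μ.maxSize := by
    by_contra! hlt
    rw [μ.atomCount_eq_zero_of_maxSize_lt hlt,
      ν.atomCount_eq_zero_of_maxSize_lt (hmax ▸ hlt)] at hn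
    exact hn rfl
  have hspec := Nat.findGreatest_spec (P := fun n => μ.atomCount n ≠ ν.atomCount n) hn' hn
  have hgt (k : ℕ)
      (hk : Nat.findGreatest (fun n => μ.atomCount n ≠ ν.atomCount n) μ.maxSize < k) :
      μ.atomCount k = ν.atomCount k := by
    by_cases hk' : k ≤ μ.maxSize
    · exact not_not.1 (Nat.findGreatest_is_greatest hk hk')
    · rw [μ.atomCount_eq_zero_of_maxSize_lt (by omega),
        ν.atomCount_eq_zero_of_maxSize_lt (by omega)]
  rcases lt_or_gt_of_ne hspec with h | h
  · exact h2.2 ⟨hmax, _, h, hgt⟩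
  · exact h1.2 ⟨hmax.symm, _, h, fun k hk => (hgt k hk).symm⟩

theorem HasUniqueMinimal.type_unique {t t' : List ℕ} (h : HasUniqueMinimal β t)
    (h' : HasUniqueMinimal β t') : t = t' := by
  obtain ⟨μ, hμ, rfl, -⟩ := h
  obtain ⟨ν, hν, rfl, -⟩ := h'
  exact hμ.type_eq hν

theorem HasExactlyTwoMinimal.type_unique {t t' : List ℕ} (h : HasExactlyTwoMinimal β t)
    (h' : HasExactlyTwoMinimal β t') : t = t' := by
  obtain ⟨μ, -, hμ, -, rfl, -⟩ := h
  obtain ⟨ν, -, hν, -, rfl, -⟩ := h'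
  exact hμ.type_eq hν

theorem HasUniqueMinimal.not_hasExactlyTwoMinimal {t t' : List ℕ} (h : HasUniqueMinimal β t) :
    ¬ HasExactlyTwoMinimal β t' := by
  rintro ⟨μ₁, μ₂, h₁, h₂, -, -, hne, -⟩
  obtain ⟨μ, -, -, hμ⟩ := h
  exact hne ((hμ μ₁ h₁).trans (hμ μ₂ h₂).symm)

theorem Feasible.hasUniqueMinimal (h : FeasibleFor β P Q) (hβ : CircleRelations β)
    (hne : β [X, X, Y, Y] ≠ 0)
    (huniq : ∀ P' Q', FeasibleFor β P' Q' →
      P' = P ∧ Q' = Q ∨ pointCountFor β P Q < pointCountFor β P' Q') :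
    HasUniqueMinimal β [pointCountFor β P Q, 1] := by
  refine ⟨h.measure, h.isMinimal hβ hne fun P' Q' h' => ?_, h.type_measure, fun ν hν => ?_⟩
  · rcases huniq P' Q' h' with ⟨rfl, rfl⟩ | hlt
    · exact le_rfl
    · exact hlt.le
  · obtain ⟨P', Q', h', hle, he⟩ := hν.exists_feasible hβ hne h
    rcases huniq P' Q' h' with ⟨rfl, rfl⟩ | hlt
    · exact he
    · exact absurd hle hlt.not_ge

theorem Feasible.hasExactlyTwoMinimal {P₁ Q₁ P₂ Q₂ : ℝ} (h₁ : FeasibleFor β P₁ Q₁)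
    (h₂ : FeasibleFor β P₂ Q₂) (hβ : CircleRelations β) (hne : β [X, X, Y, Y] ≠ 0)
    (hP : P₁ ≠ P₂) (hcount : pointCountFor β P₁ Q₁ = pointCountFor β P₂ Q₂)
    (htwo : ∀ P' Q', FeasibleFor β P' Q' →
      P' = P₁ ∧ Q' = Q₁ ∨ P' = P₂ ∧ Q' = Q₂ ∨ pointCountFor β P₁ Q₁ < pointCountFor β P' Q') :
    HasExactlyTwoMinimal β [pointCountFor β P₁ Q₁, 1] := by
  have hmin (P' Q') (h' : FeasibleFor β P' Q') :
      pointCountFor β P₁ Q₁ ≤ pointCountFor β P' Q' := by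
    rcases htwo P' Q' h' with ⟨rfl, rfl⟩ | ⟨rfl, rfl⟩ | hlt
    · exact le_rfl
    · exact hcount.le
    · exact hlt.le
  refine ⟨h₁.measure, h₂.measure, h₁.isMinimal hβ hne hmin,
    h₂.isMinimal hβ hne fun P' Q' h' => hcount ▸ hmin P' Q' h', h₁.type_measure, ?_,
    fun he => hP (h₁.eq_of_orthEquiv h₂ he), fun ν hν => ?_⟩
  · rw [h₂.type_measure, hcount]
  · obtain ⟨P', Q', h', hle, he⟩ := hν.exists_feasible hβ hne h₁
    rcases htwo P' Q' h' with ⟨rfl, rfl⟩ | ⟨rfl, rfl⟩ | hlt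
    · exact Or.inl he
    · exact Or.inr he
    · exact absurd hle hlt.not_ge

end Minimal

/-! ### The curve `PQ = d (P + Q)` in the rectangle -/

section Curve

variable {a b p d P Q : ℝ}

theorem feasible_corner (hP : 0 < p - |a|) (hQ : 0 < 1 - p - |b|)
    (h : (p - |a|) * (1 - p - |b|) = d * ((p - |a|) + (1 - p - |b|))) :
    Feasible a b p d (p - |a|) (1 - p - |b|) :=
  ⟨hP, hQ, le_rfl, le_rfl, h⟩

/-- The curve is `1/P + 1/Q = 1/d`, and the left side strictly decreases in each variable, so a
curve through the corner contains no other point of the rectangle. `key` is this comparison with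
denominators cleared. -/
theorem Feasible.eq_corner (hf : Feasible a b p d P Q) (hd : 0 < d)
    (h : (p - |a|) * (1 - p - |b|) = d * ((p - |a|) + (1 - p - |b|))) :
    P = p - |a| ∧ Q = 1 - p - |b| := by
  obtain ⟨hP, hQ, hP', hQ', hc⟩ := hf
  generalize p - |a| = P₀ at *
  generalize 1 - p - |b| = Q₀ at *
  have hP₀ : 0 < P₀ := hP.trans_le hP'
  have hQ₀ : 0 < Q₀ := hQ.trans_le hQ'
  have key : P * P₀ * (Q₀ - Q) + Q * Q₀ * (P₀ - P) = 0 := by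
    apply mul_left_cancel₀ hd.ne'
    linear_combination (P * Q) * h - (P₀ * Q₀) * hc
  have h1 : 0 ≤ P * P₀ * (Q₀ - Q) := mul_nonneg (by positivity) (sub_nonneg.2 hQ')
  have h2 : 0 ≤ Q * Q₀ * (P₀ - P) := mul_nonneg (by positivity) (sub_nonneg.2 hP')
  have h3 : P * P₀ * (Q₀ - Q) = 0 := by linarith
  have h4 : Q * Q₀ * (P₀ - P) = 0 := by linarith
  have h5 := (mul_eq_zero.1 h3).resolve_left (by positivity)
  have h6 := (mul_eq_zero.1 h4).resolve_left (by positivity)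
  constructor <;> linarith

/-- With one coordinate fixed at the edge value `R`, the curve gives `d R / (R - d)` for the other;
strictness of `h` keeps it away from the corner. -/
theorem div_sub_bounds {R S : ℝ} (hd : 0 < d) (hR : 0 < R) (hS : 0 < S) (h : d * (R + S) < R * S) :
    0 < R - d ∧ 0 < d * R / (R - d) ∧ d * R / (R - d) < S ∧
      R * (d * R / (R - d)) = d * (R + d * R / (R - d)) := by
  have h1 : 0 < R - d := by
    by_contra! h'
    nlinarith [mul_le_mul_of_nonneg_right (sub_nonpos.1 h') hS.le, mul_pos hd hR]
  refine ⟨h1, by positivity, ?_, ?_⟩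
  · rw [div_lt_iff₀ h1]
    linarith
  · field_simp
    ring

theorem feasible_left (hd : 0 < d) (hP : 0 < p - |a|) (hQ : 0 < 1 - p - |b|)
    (h : d * ((p - |a|) + (1 - p - |b|)) < (p - |a|) * (1 - p - |b|)) :
    Feasible a b p d (p - |a|) (d * (p - |a|) / (p - |a| - d)) := by
  obtain ⟨-, h2, h3, h4⟩ := div_sub_bounds hd hP hQ h
  exact ⟨hP, h2, le_rfl, h3.le, h4⟩

theorem feasible_right (hd : 0 < d) (hP : 0 < p - |a|) (hQ : 0 < 1 - p - |b|)
    (h : d * ((p - |a|) + (1 - p - |b|)) < (p - |a|) * (1 - p - |b|)) :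
    Feasible a b p d (d * (1 - p - |b|) / (1 - p - |b| - d)) (1 - p - |b|) := by
  obtain ⟨-, h2, h3, h4⟩ := div_sub_bounds (R := 1 - p - |b|) hd hQ hP (by linarith)
  exact ⟨h2, hQ, h3.le, le_rfl, by linarith⟩

theorem Feasible.cases_of_lt (hf : Feasible a b p d P Q) (hd : 0 < d) (hP : 0 < p - |a|)
    (hQ : 0 < 1 - p - |b|) (h : d * ((p - |a|) + (1 - p - |b|)) < (p - |a|) * (1 - p - |b|)) :
    (P = p - |a| ∧ Q = d * (p - |a|) / (p - |a| - d)) ∨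
      (P = d * (1 - p - |b|) / (1 - p - |b| - d) ∧ Q = 1 - p - |b|) ∨
      pointCount a b p P Q = 4 := by
  have hc := hf.curve
  rcases hf.P_le.eq_or_lt with hPe | hPl
  · left
    refine ⟨hPe, ?_⟩
    rw [eq_div_iff (div_sub_bounds hd hP hQ h).1.ne', ← hPe]
    linarith
  rcases hf.Q_le.eq_or_lt with hQe | hQl
  · right; left
    refine ⟨?_, hQe⟩
    rw [eq_div_iff (div_sub_bounds (R := 1 - p - |b|) hd hQ hP (by linarith)).1.ne', ← hQe]
    linarith
  · right; right
    rw [pointCount_eq, axisCount_of_abs_lt (by linarith), axisCount_of_abs_lt (by linarith)]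

theorem pointCount_corner : pointCount a b p (p - |a|) (1 - p - |b|) =
    axisCount |a| a + axisCount |b| b := by
  rw [pointCount_eq, sub_sub_cancel, sub_sub_cancel]

theorem pointCount_left (hd : 0 < d) (hP : 0 < p - |a|) (hQ : 0 < 1 - p - |b|)
    (h : d * ((p - |a|) + (1 - p - |b|)) < (p - |a|) * (1 - p - |b|)) :
    pointCount a b p (p - |a|) (d * (p - |a|) / (p - |a| - d)) = axisCount |a| a + 2 := by
  have := (div_sub_bounds hd hP hQ h).2.2.1
  rw [pointCount_eq, sub_sub_cancel, axisCount_of_abs_lt (u := 1 - p - _) (by linarith)]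

theorem pointCount_right (hd : 0 < d) (hP : 0 < p - |a|) (hQ : 0 < 1 - p - |b|)
    (h : d * ((p - |a|) + (1 - p - |b|)) < (p - |a|) * (1 - p - |b|)) :
    pointCount a b p (d * (1 - p - |b|) / (1 - p - |b| - d)) (1 - p - |b|) =
      2 + axisCount |b| b := by
  have := (div_sub_bounds (R := 1 - p - |b|) hd hQ hP (by linarith)).2.2.1
  rw [pointCount_eq, sub_sub_cancel, axisCount_of_abs_lt (u := p - _) (by linarith)]

end Curve

/-! ### Classification of the minimal measures -/

section Classification

variable {β : Word → ℝ}

/-- In terms of the rectangle, `c = p - P₀ Q₀ / (P₀ + Q₀)`: the bound says that the corner lies on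
or beyond the curve, with equality when it lies on it. -/
theorem lowerBound_eq (h : 0 < (β [X, X] - |β [X]|) + (1 - β [X, X] - |β [Y]|)) :
    lowerBound β = β [X, X] - (β [X, X] - |β [X]|) * (1 - β [X, X] - |β [Y]|) /
      ((β [X, X] - |β [X]|) + (1 - β [X, X] - |β [Y]|)) := by
  rw [lowerBound, abs_mul, div_eq_iff (by linarith), sub_mul]
  have : (β [X, X] - |β [X]|) * (1 - β [X, X] - |β [Y]|) /
      ((β [X, X] - |β [X]|) + (1 - β [X, X] - |β [Y]|)) * (-1 + |β [Y]| + |β [X]|) =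
      -((β [X, X] - |β [X]|) * (1 - β [X, X] - |β [Y]|)) := by
    rw [show -1 + |β [Y]| + |β [X]| =
      -((β [X, X] - |β [X]|) + (1 - β [X, X] - |β [Y]|)) by ring, mul_neg,
      div_mul_cancel₀ _ h.ne']
  rw [this]
  ring

theorem lowerBound_le_iff (h : 0 < (β [X, X] - |β [X]|) + (1 - β [X, X] - |β [Y]|)) :
    lowerBound β ≤ β [X, X, X, X] ↔
      (β [X, X] - β [X, X, X, X]) * ((β [X, X] - |β [X]|) + (1 - β [X, X] - |β [Y]|)) ≤
        (β [X, X] - |β [X]|) * (1 - β [X, X] - |β [Y]|) := by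
  rw [lowerBound_eq h, ← le_div_iff₀ h]
  constructor <;> intro h' <;> linarith

theorem eq_lowerBound_iff (h : 0 < (β [X, X] - |β [X]|) + (1 - β [X, X] - |β [Y]|)) :
    β [X, X, X, X] = lowerBound β ↔
      (β [X, X] - |β [X]|) * (1 - β [X, X] - |β [Y]|) =
        (β [X, X] - β [X, X, X, X]) * ((β [X, X] - |β [X]|) + (1 - β [X, X] - |β [Y]|)) := by
  rw [lowerBound_eq h, ← div_eq_iff h.ne']
  constructor <;> intro h' <;> linarith

/-- If `X` and `Y` have zero moment and `X⁴` has the least possible one, the column of `X²` is a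
multiple of the column of `1`. -/
theorem rank_lt_of_degenerate (hβ : CircleRelations β)
    (hXY : (momentMatrix β).col 4 + (momentMatrix β).col 5 = 0)
    (hXX : (momentMatrix β).col 3 + (momentMatrix β).col 6 = (momentMatrix β).col 0)
    (hX : β [X] = 0) (hY : β [Y] = 0) (hq : β [X, X, X, X] = β [X, X] ^ 2) :
    (momentMatrix β).rank < 5 := by
  have h3 : (momentMatrix β).col 3 = β [X, X] • (momentMatrix β).col 0 := by
    funext i
    change β ((wordsTwo i).reverse ++ [X, X]) = β [X, X] * β ((wordsTwo i).reverse ++ [])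
    rw [hβ.eq_circleValue (w := (wordsTwo i).reverse ++ [X, X]) (by fin_cases i <;> simp [wordsTwo]),
      hβ.eq_circleValue (w := (wordsTwo i).reverse ++ []) (by fin_cases i <;> simp [wordsTwo]),
      hX, hY, hq]
    fin_cases i <;> simp [wordsTwo, circleValue] <;> ring
  classical
  let S : Finset (Fin 7 → ℝ) := {(momentMatrix β).col 0, (momentMatrix β).col 1,
    (momentMatrix β).col 2, (momentMatrix β).col 4}
  have hS : Submodule.span ℝ (Set.range (momentMatrix β).col) ≤ Submodule.span ℝ (S : Set _) := by
    have m0 : (momentMatrix β).col 0 ∈ Submodule.span ℝ (S : Set (Fin 7 → ℝ)) :=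
      Submodule.subset_span (by simp [S])
    have m1 : (momentMatrix β).col 1 ∈ Submodule.span ℝ (S : Set (Fin 7 → ℝ)) :=
      Submodule.subset_span (by simp [S])
    have m2 : (momentMatrix β).col 2 ∈ Submodule.span ℝ (S : Set (Fin 7 → ℝ)) :=
      Submodule.subset_span (by simp [S])
    have m4 : (momentMatrix β).col 4 ∈ Submodule.span ℝ (S : Set (Fin 7 → ℝ)) :=
      Submodule.subset_span (by simp [S])
    have m3 : (momentMatrix β).col 3 ∈ Submodule.span ℝ (S : Set (Fin 7 → ℝ)) :=
      h3 ▸ Submodule.smul_mem _ _ m0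
    have m5 : (momentMatrix β).col 5 ∈ Submodule.span ℝ (S : Set (Fin 7 → ℝ)) := by
      rw [eq_neg_of_add_eq_zero_right hXY]
      exact Submodule.neg_mem _ m4
    have m6 : (momentMatrix β).col 6 ∈ Submodule.span ℝ (S : Set (Fin 7 → ℝ)) := by
      rw [eq_sub_of_add_eq' hXX]
      exact Submodule.sub_mem _ m0 m3
    rw [Submodule.span_le]
    rintro _ ⟨i, rfl⟩
    fin_cases i
    exacts [m0, m1, m2, m3, m4, m5, m6]
  have hcard : S.card ≤ 4 := Finset.card_le_four
  rw [rank_eq_finrank_span_cols]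
  have h1 := Submodule.finrank_mono hS
  have h2 := finrank_span_finset_le_card (R := ℝ) S
  exact ((h1.trans h2).trans hcard).trans_lt (by norm_num)

/-- The classification of the minimal measures of a sequence satisfying the inequalities. -/
theorem minimal_classification (hβ : CircleRelations β)
    (hd : 0 < β [X, X] - β [X, X, X, X])
    (hP : 0 < β [X, X] - |β [X]|) (hQ : 0 < 1 - β [X, X] - |β [Y]|)
    (hle : (β [X, X] - β [X, X, X, X]) * ((β [X, X] - |β [X]|) + (1 - β [X, X] - |β [Y]|)) ≤
        (β [X, X] - |β [X]|) * (1 - β [X, X] - |β [Y]|))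
    (hndeg : ¬ (β [X] = 0 ∧ β [Y] = 0 ∧ β [X, X, X, X] = lowerBound β)) :
    (HasUniqueMinimal β [1, 1] ∧ β [X] * β [Y] = 0 ∧ (β [X] ≠ 0 ∨ β [Y] ≠ 0) ∧
        β [X, X, X, X] = lowerBound β) ∨
      (HasUniqueMinimal β [2, 1] ∧
        ((β [X] * β [Y] = 0 ∧ (β [X] ≠ 0 ∨ β [Y] ≠ 0) ∧ β [X, X, X, X] ≠ lowerBound β) ∨
        (β [X] * β [Y] ≠ 0 ∧ β [X, X, X, X] = lowerBound β))) ∨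
      (HasExactlyTwoMinimal β [2, 1] ∧ β [X] = 0 ∧ β [Y] = 0 ∧
        β [X, X, X, X] ≠ lowerBound β) ∨
      (HasExactlyTwoMinimal β [3, 1] ∧ β [X] * β [Y] ≠ 0 ∧ β [X, X, X, X] ≠ lowerBound β) := by
  have hne : β [X, X, Y, Y] ≠ 0 := by
    rw [hβ.eq_circleValue (w := [X, X, Y, Y]) (by simp)]
    exact hd.ne'
  have hiff := eq_lowerBound_iff (add_pos hP hQ)
  have zero {x : ℝ} (hx : x = 0) : axisCount |x| x = 0 := by rw [hx]; exact axisCount_zero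
  by_cases hq : β [X, X, X, X] = lowerBound β
  · have hcorner := hiff.1 hq
    have hf : FeasibleFor β _ _ := feasible_corner hP hQ hcorner
    have hu := hf.hasUniqueMinimal hβ hne fun P' Q' h' => Or.inl (h'.eq_corner hd hcorner)
    rw [pointCountFor, pointCount_corner] at hu
    by_cases hX : β [X] = 0
    · have hY : β [Y] ≠ 0 := fun hY => hndeg ⟨hX, hY, hq⟩
      rw [zero hX, axisCount_abs hY] at hu
      exact Or.inl ⟨hu, by rw [hX, zero_mul], Or.inr hY, hq⟩
    · by_cases hY : β [Y] = 0
      · rw [zero hY, axisCount_abs hX] at hu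
        exact Or.inl ⟨hu, by rw [hY, mul_zero], Or.inl hX, hq⟩
      · rw [axisCount_abs hY, axisCount_abs hX] at hu
        exact Or.inr (Or.inl ⟨hu, Or.inr ⟨mul_ne_zero hX hY, hq⟩⟩)
  · have hlt := lt_of_le_of_ne hle fun h => hq (hiff.2 h.symm)
    have hl : FeasibleFor β _ _ := feasible_left hd hP hQ hlt
    have hr : FeasibleFor β _ _ := feasible_right hd hP hQ hlt
    have cl := pointCount_left hd hP hQ hlt
    have cr := pointCount_right hd hP hQ hlt
    have hcases {P' Q' : ℝ} (h' : FeasibleFor β P' Q') := h'.cases_of_lt hd hP hQ hlt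
    -- The endpoint on the edge `Q = Q₀` has `P < P₀`, so the two endpoints are distinct.
    have hPne := (div_sub_bounds (R := 1 - β [X, X] - |β [Y]|) hd hQ hP (by linarith)).2.2.1.ne'
    by_cases hX : β [X] = 0
    · rw [zero hX] at cl
      by_cases hY : β [Y] = 0
      · rw [zero hY] at cr
        have hu := hl.hasExactlyTwoMinimal hr hβ hne hPne (cl.trans cr.symm) fun P' Q' h' => by
          rcases hcases h' with h | h | h
          · exact Or.inl h
          · exact Or.inr (Or.inl h)
          · exact Or.inr (Or.inr (by rw [pointCountFor, pointCountFor, cl, h]; norm_num))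
        rw [pointCountFor, cl] at hu
        exact Or.inr (Or.inr (Or.inl ⟨hu, hX, hY, hq⟩))
      · rw [axisCount_abs hY] at cr
        have hu := hl.hasUniqueMinimal hβ hne fun P' Q' h' => by
          rcases hcases h' with h | ⟨rfl, rfl⟩ | h
          · exact Or.inl h
          · exact Or.inr (by rw [pointCountFor, pointCountFor, cl, cr]; norm_num)
          · exact Or.inr (by rw [pointCountFor, pointCountFor, cl, h]; norm_num)
        rw [pointCountFor, cl] at hu
        exact Or.inr (Or.inl ⟨hu, Or.inl ⟨by rw [hX, zero_mul], Or.inr hY, hq⟩⟩)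
    · rw [axisCount_abs hX] at cl
      by_cases hY : β [Y] = 0
      · rw [zero hY] at cr
        have hu := hr.hasUniqueMinimal hβ hne fun P' Q' h' => by
          rcases hcases h' with ⟨rfl, rfl⟩ | h | h
          · exact Or.inr (by rw [pointCountFor, pointCountFor, cl, cr]; norm_num)
          · exact Or.inl h
          · exact Or.inr (by rw [pointCountFor, pointCountFor, cr, h]; norm_num)
        rw [pointCountFor, cr] at hu
        exact Or.inr (Or.inl ⟨hu, Or.inl ⟨by rw [hY, mul_zero], Or.inl hX, hq⟩⟩)
      · rw [axisCount_abs hY] at cr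
        have hu := hl.hasExactlyTwoMinimal hr hβ hne hPne (cl.trans cr.symm) fun P' Q' h' => by
          rcases hcases h' with h | h | h
          · exact Or.inl h
          · exact Or.inr (Or.inl h)
          · exact Or.inr (Or.inr (by rw [pointCountFor, pointCountFor, cl, h]; norm_num))
        rw [pointCountFor, cl] at hu
        exact Or.inr (Or.inr (Or.inr ⟨hu, mul_ne_zero hX hY, hq⟩))

theorem HasUniqueMinimal.admitsNCMeasure {m : ℕ} (h : HasUniqueMinimal β [m, 1]) :
    AdmitsNCMeasure β := by
  obtain ⟨μ, hμ, ht, -⟩ := h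
  have := congrArg List.length ht
  simp only [AtomicMeasure.type, List.length_map, List.length_range, List.length_cons,
    List.length_nil] at this
  exact ⟨μ, hμ, by omega⟩

theorem HasExactlyTwoMinimal.admitsNCMeasure {m : ℕ} (h : HasExactlyTwoMinimal β [m, 1]) :
    AdmitsNCMeasure β := by
  obtain ⟨μ, -, hμ, -, ht, -⟩ := h
  have := congrArg List.length ht
  simp only [AtomicMeasure.type, List.length_map, List.length_range, List.length_cons,
    List.length_nil] at this
  exact ⟨μ, hμ, by omega⟩

end Classification

end TracialMoment

/-! ### The main theorem -/

open TracialMoment Letter in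
theorem theorem6p4 (β : Word → ℝ) (htracial : IsTracial β) (hnorm : IsNormalized β)
    (hnc : IsNoncommutative β) (hrank : (momentMatrix β).rank = 5)
    -- the column relations XY + YX = 0 and X² + Y² = 1
    (hXY : (momentMatrix β).col 4 + (momentMatrix β).col 5 = 0)
    (hXX : (momentMatrix β).col 3 + (momentMatrix β).col 6 = (momentMatrix β).col 0) :
    (AdmitsNCMeasure β ↔
      |β [Y]| < 1 - |β [X]| ∧
      (|β [X]| < β [X, X] ∧ β [X, X] < 1 - |β [Y]|) ∧
      (lowerBound β ≤ β [X, X, X, X] ∧ β [X, X, X, X] < β [X, X])) ∧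
    (AdmitsNCMeasure β →
      (HasUniqueMinimal β [1, 1] ↔
        β [X] * β [Y] = 0 ∧ β [X, X, X, X] = lowerBound β) ∧
      (HasUniqueMinimal β [2, 1] ↔
        (β [X] * β [Y] = 0 ∧ (β [X] ≠ 0 ∨ β [Y] ≠ 0) ∧ β [X, X, X, X] ≠ lowerBound β) ∨
        (β [X] * β [Y] ≠ 0 ∧ β [X, X, X, X] = lowerBound β)) ∧
      (HasExactlyTwoMinimal β [2, 1] ↔ β [X] = 0 ∧ β [Y] = 0) ∧
      (HasExactlyTwoMinimal β [3, 1] ↔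
        β [X] * β [Y] ≠ 0 ∧ β [X, X, X, X] ≠ lowerBound β)) := by
  have hβ := CircleRelations.of_momentMatrix htracial hnorm hXY hXX
  have hne : β [X, X, X, X] ≠ β [X, X] := by
    intro h
    apply hnc
    rw [hβ.eq_circleValue (w := [X, X, Y, Y]) (by simp),
      hβ.eq_circleValue (w := [X, Y, X, Y]) (by simp)]
    simp only [circleValue, h, sub_self]
  -- Here `c` reduces to `p²`, which contradicts rank five. This is why the first case need not
  -- exclude `a = b = 0` and the third need not require `q ≠ c`.
  have hndeg : ¬ (β [X] = 0 ∧ β [Y] = 0 ∧ β [X, X, X, X] = lowerBound β) := by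
    rintro ⟨hX, hY, hq⟩
    refine absurd hrank (rank_lt_of_degenerate hβ hXY hXX hX hY ?_).ne
    rw [hq, lowerBound, hX, hY]
    simp
  have hnec : AdmitsNCMeasure β → _ := fun ⟨μ, hμ, _⟩ => hμ.1.necessary hβ hne
  constructor
  · constructor
    · intro h
      obtain ⟨hd, hP, hQ, hle⟩ := hnec h
      exact ⟨by linarith, ⟨by linarith, by linarith⟩,
        (lowerBound_le_iff (add_pos hP hQ)).2 hle, by linarith⟩
    · rintro ⟨-, ⟨hP, hQ⟩, hle, hd⟩
      have hP' : 0 < β [X, X] - |β [X]| := sub_pos.2 hP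
      have hQ' : 0 < 1 - β [X, X] - |β [Y]| := by linarith
      rcases minimal_classification hβ (sub_pos.2 hd) hP' hQ'
        ((lowerBound_le_iff (add_pos hP' hQ')).1 hle) hndeg with ⟨h, -⟩ | ⟨h, -⟩ | ⟨h, -⟩ | ⟨h, -⟩
      · exact h.admitsNCMeasure
      · exact h.admitsNCMeasure
      · exact h.admitsNCMeasure
      · exact h.admitsNCMeasure
  · intro h
    obtain ⟨hd, hP, hQ, hle⟩ := hnec h
    have uu (h : HasUniqueMinimal β [1, 1]) (h' : HasUniqueMinimal β [2, 1]) : False :=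
      absurd (h.type_unique h') (by decide)
    have tt (h : HasExactlyTwoMinimal β [2, 1]) (h' : HasExactlyTwoMinimal β [3, 1]) : False :=
      absurd (h.type_unique h') (by decide)
    have ut₁ (t t' : List ℕ) (h : HasUniqueMinimal β t) : ¬ HasExactlyTwoMinimal β t' :=
      h.not_hasExactlyTwoMinimal
    have u12 := ut₁ [1, 1] [2, 1]
    have u13 := ut₁ [1, 1] [3, 1]
    have u22 := ut₁ [2, 1] [2, 1]
    have u23 := ut₁ [2, 1] [3, 1]
    have hcl := minimal_classification hβ hd hP hQ hle hndeg
    simp only [ne_eq, mul_eq_zero] at hcl ⊢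
    clear ut₁ hnec h hd hP hQ hle hne hβ hXX hXY hrank hnc hnorm htracial
    generalize HasUniqueMinimal β [1, 1] = u₁ at *
    generalize HasUniqueMinimal β [2, 1] = u₂ at *
    generalize HasExactlyTwoMinimal β [2, 1] = t₂ at *
    generalize HasExactlyTwoMinimal β [3, 1] = t₃ at *
    generalize (β [X, X, X, X] = lowerBound β) = e at *
    generalize (β [X] = 0) = x at *
    generalize (β [Y] = 0) = y at *
    -- Exactly one outcome occurs for each truth value of `a = 0`, `b = 0`, `q = c`, and the
    -- outcomes exclude each other, so the equivalences are propositional.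
    by_cases hx : x <;> by_cases hy : y <;> by_cases he : e <;>
      simp only [hx, hy, he, and_true, and_false, or_true, or_false, false_or,
        not_true_eq_false, not_false_eq_true, or_self, and_self, iff_true,
        iff_false] at hcl hndeg ⊢ <;> tauto
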